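/- **Conventions.** Let $(X,\|\cdot\|)$ be a complex normed space and $\tau$ a Hausdorff locally convex topology on $X$ coarser than the norm topology; then $(X,\|\cdot\|,\tau)$ is a *pre-Saks space*. Its *mixed topology* $\gamma=\gamma(\|\cdot\|,\tau)$ is the finest linear topology with $\tau\subset\gamma\subset\tau_{\|\cdot\|}$ that coincides with $\tau$ on $\|\cdot\|$-bounded sets. The space is *sequentially complete* (*C-sequential*) if every Cauchy sequence of $(X,\gamma)$ converges (every convex sequentially open subset of $(X,\gamma)$ is open). It is a *Saks space* if there is a directed system $\Gamma$ of continuous seminorms that generates $\tau$ with $\|x\|=\sup_{p\in\Gamma}p(x)$ for all $x$; for such $\Gamma$, the *submixed topology* $\gamma_s$ is generated by the seminorms $x\mapsto\sup_n p_n(x)a_n$ with $p_n\in\Gamma$, $a_n\ge 0$, $a_n\to 0$. Let $(T(t))_{t\ge0}$ be a semigroup of linear maps on $X$, and let $\sigma\in\{\tau,\gamma\}$. * It is *locally bounded* if $\sup_{t\in[0,t_0]}\|T(t)\|<\infty$ for all $t_0\ge 0$, and *$\sigma$-strongly continuous* if each $T(t)$ is $\sigma$-continuous and each orbit $t\mapsto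 T(t)x$ is $\sigma$-continuous on $[0,\infty)$. * A family $(S_i)_{i\in I}$ of linear maps on $X$ is *$\sigma$-equicontinuous* if for every $\sigma$-continuous seminorm $p$ there are a $\sigma$-continuous seminorm $q$ and $C\ge 0$ with $p(S_ix)\le Cq(x)$ for all $i\in I$, $x\in X$. It is *$(\|\cdot\|,\tau)$-equitight* if for every $\varepsilon>0$ and every $\tau$-continuous seminorm $p$ there are a $\tau$-continuous seminorm $q$ and $C\ge0$ with $p(S_ix)\le Cq(x)+\varepsilon\|x\|$ for all $i\in I$, $x\in X$. "*Locally*" means that $(T(t))_{t\in[0,t_0]}$ has the property for every $t_0\ge0$; "*quasi-*" means that $(e^{-\omega t}T(t))_{t\ge0}$ has it for some $\omega\in\mathbb R$. * It is *$\tau$-bi-continuous* if it is exponentially bounded ($\|T(t)\|\le Me^{\omega t}$ for all $t\ge 0$, with some $M\ge1$, $\omega\in\mathbb R$), all orbits are $\tau$-continuous, and for every $\|\cdot\|$-bounded sequence $(x_n)$ that $\tau$-converges to some $x\in X$ and every $t_0\ge0$ one has $T(t)(x_n-x)\to0$ in $\tau$ uniformly in $t\in[0,t_0]$. * Its *generator*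 is $Ax=\gamma\text{-}\lim_{t\to0+}\frac{T(t)x-x}{t}$, and $D(A)$ is the set of all $x\in X$ for which this limit exists in $X$. Let $\Omega\subset\mathbb C$ be open and $\mathcal H(\Omega)$ the space of holomorphic functions on $\Omega$. A *holomorphic $C_0$-co-semiflow* $(m,\varphi)$ on $\Omega$ consists of families $(\varphi_t)_{t\ge0}$ of holomorphic maps $\varphi_t\colon\Omega\to\Omega$ and $(m_t)_{t\ge0}$ in $\mathcal H(\Omega)$ with $\varphi_0=\mathrm{id}$, $\varphi_{t+s}=\varphi_t\circ\varphi_s$, $m_0=1$, $m_{t+s}=m_t\cdot(m_s\circ\varphi_t)$ for all $t,s\ge 0$, and $\lim_{t\to0+}\varphi_t(z)=z$, $\lim_{t\to0+}m_t(z)=1$ for all $z\in\Omega$. Dots denote derivatives in $t$ (one-sided at $t=0$), and $\tau_{\mathrm{co}}$ is the topology of uniform convergence on compact subsets of $\Omega$. **Theorem.** Let $\Omega\subset\mathbb C$ be open, $(\mathcal F,\|\cdot\|,\tau_{\mathrm{co}})$ a sequentially complete pre-Saks space with $\mathcal F\subset\mathcal H(\Omega)$ a linear subspace, and $(m,\varphi)$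 a holomorphic $C_0$-co-semiflow on $\Omega$ such that $C_{m,\varphi}(t)f:=m_t\cdot(f\circ\varphi_t)\in\mathcal F$ for all $f\in\mathcal F$, $t\ge0$, and such that the semigroup $(C_{m,\varphi}(t))_{t\ge0}$ on $\mathcal F$ is locally bounded. Then the following hold. (a) $(C_{m,\varphi}(t))_{t\ge0}$ is $\gamma$-strongly continuous, locally $\tau_{\mathrm{co}}$-equicontinuous and locally $\gamma$-equicontinuous. (b) If $(\mathcal F,\|\cdot\|,\tau_{\mathrm{co}})$ is a Saks space, then $(C_{m,\varphi}(t))_{t\ge0}$ is $\tau_{\mathrm{co}}$-bi-continuous. (c) If $(\mathcal F,\|\cdot\|,\tau_{\mathrm{co}})$ is a C-sequential Saks space, then $(C_{m,\varphi}(t))_{t\ge0}$ is quasi-$\gamma$-equicontinuous. If additionally $\gamma=\gamma_s$ (for some $\Gamma$ as above), then it is quasi-$(\|\cdot\|,\tau_{\mathrm{co}})$-equitight. (d) If $t\mapsto m_t(z)$ is in $\mathcal C^1[0,\infty)$ for all $z\in\Omega$, then $t\mapsto\varphi_t(z)$ is in $\mathcal C^1[0,\infty)$ for all $z\in\Omega$,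 $\dot\varphi_0\in\mathcal H(\Omega)$, and the generator $(A,D(A))$ of $(C_{m,\varphi}(t))_{t\ge0}$ satisfies $$D(A)=\{f\in\mathcal F\mid \dot\varphi_0f'+\dot m_0f\in\mathcal F\},\qquad Af=\dot\varphi_0f'+\dot m_0f\quad(f\in D(A)).$$ (e) If $t\mapsto m_t(z)$ is in $\mathcal C^1[0,\infty)$ for all $z\in\Omega$ and $(\mathcal F,\|\cdot\|)$ is complete, then (besides the assertions of (d)) $$\bigl\{f\in\mathcal F\mid \lim_{t\to0+}\|C_{m,\varphi}(t)f-f\|=0\bigr\}=\overline{\{f\in\mathcal F\mid \dot\varphi_0f'+\dot m_0f\in\mathcal F\}}^{\|\cdot\|}.$$ -/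

import Mathlib

open Filter Set
open scoped Topology NNReal

namespace Saks

section Topologies

variable {X : Type*} [AddCommGroup X] [Module ℂ X]

/-- The topology generated by a set of seminorms. -/
@[reducible] def seminormTopology (Γ : Set (Seminorm ℂ X)) : TopologicalSpace X :=
  ⨅ p ∈ Γ, p.toSeminormedAddCommGroup.toUniformSpace.toTopologicalSpace

/-- The topology of a norm `ν`. -/
@[reducible] def normTopology (ν : Seminorm ℂ X) : TopologicalSpace X := seminormTopology {ν}

/-- `σ` is a linear (vector space) topology. -/
def IsLinearTopology (σ : TopologicalSpace X) : Prop :=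
  @IsTopologicalAddGroup X σ _ ∧ @ContinuousSMul ℂ X _ _ σ

/-- `(X, ν, τ)` is a pre-Saks space: `ν` is a norm and `τ` a Hausdorff locally convex topology
coarser than the norm topology (in Mathlib's order, `σ ≤ τ` means that `σ` is finer). -/
structure IsPreSaks (ν : Seminorm ℂ X) (τ : TopologicalSpace X) : Prop where
  norm_definite : ∀ x, ν x = 0 → x = 0
  linear : IsLinearTopology τ
  locallyConvex : @LocallyConvexSpace ℝ X _ _ _ _ τ
  hausdorff : @T2Space X τ
  coarser : normTopology ν ≤ τ

/-- The linear topologies between `τ` and the norm topology that coincide with `τ` on all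
norm-bounded sets. -/
def mixedCandidates (ν : Seminorm ℂ X) (τ : TopologicalSpace X) : Set (TopologicalSpace X) :=
  {σ | IsLinearTopology σ ∧ normTopology ν ≤ σ ∧ σ ≤ τ ∧
    ∀ B : Set X, (∃ C : ℝ, ∀ x ∈ B, ν x ≤ C) →
      σ.induced ((↑) : B → X) = τ.induced ((↑) : B → X)}

/-- The mixed topology `γ(ν, τ)`: the finest of these topologies. -/
@[reducible] def mixedTopology (ν : Seminorm ℂ X) (τ : TopologicalSpace X) : TopologicalSpace X :=
  sInf (mixedCandidates ν τ)

/-- On a pre-Saks space the mixed topology is itself a candidate, hence the finest one. -/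
theorem isLeast_mixedTopology {ν : Seminorm ℂ X} {τ : TopologicalSpace X}
    (h : IsPreSaks ν τ) : IsLeast (mixedCandidates ν τ) (mixedTopology ν τ) := by
  have hτ : τ ∈ mixedCandidates ν τ := ⟨h.linear, h.coarser, le_rfl, fun _ _ => rfl⟩
  refine ⟨⟨⟨?_, ?_⟩, ?_, sInf_le hτ, ?_⟩, fun σ hσ => sInf_le hσ⟩
  · exact topologicalAddGroup_sInf fun σ hσ => hσ.1.1
  · exact continuousSMul_sInf fun σ hσ => hσ.1.2
  · exact le_sInf fun σ hσ => hσ.2.1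
  · intro B hB
    refine le_antisymm (induced_mono (sInf_le hτ)) ?_
    rw [mixedTopology, induced_sInf]
    refine le_sInf ?_
    rintro _ ⟨σ, hσ, rfl⟩
    exact (hσ.2.2.2 B hB).ge

/-- `Γ` is a directed system of continuous seminorms that generates `τ` and satisfies
`ν x = sup_{p ∈ Γ} p x` for all `x`. -/
structure IsNormingSystem (ν : Seminorm ℂ X) (τ : TopologicalSpace X)
    (Γ : Set (Seminorm ℂ X)) : Prop where
  directed : ∀ p ∈ Γ, ∀ q ∈ Γ, ∃ r ∈ Γ, ∃ C : ℝ, 0 ≤ C ∧ ∀ x, max (p x) (q x) ≤ C * r x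
  generates : τ = seminormTopology Γ
  norming : ∀ x, IsLUB {a : ℝ | ∃ p ∈ Γ, p x = a} (ν x)

/-- Saks spaces. -/
def IsSaks (ν : Seminorm ℂ X) (τ : TopologicalSpace X) : Prop :=
  IsPreSaks ν τ ∧ ∃ Γ, IsNormingSystem ν τ Γ

/-- The submixed topology of `Γ`, generated by the seminorms `x ↦ sup_n p_n(x) a_n` where
`p_n ∈ Γ` and `(a_n)` is a non-negative null sequence. -/
@[reducible] def submixedTopology (Γ : Set (Seminorm ℂ X)) : TopologicalSpace X :=
  seminormTopology {q | ∃ (p : ℕ → Seminorm ℂ X) (a : ℕ → ℝ), (∀ n, p n ∈ Γ) ∧ (∀ n, 0 ≤ a n) ∧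
    Tendsto a atTop (𝓝 0) ∧ ∀ x, IsLUB (range fun n => p n x * a n) (q x)}

/-- Every Cauchy sequence of `(X, σ)` converges. -/
def IsSeqComplete (σ : TopologicalSpace X) : Prop :=
  ∀ u : ℕ → X, Tendsto (fun k : ℕ × ℕ => u k.1 - u k.2) atTop (@nhds X σ 0) →
    ∃ x, Tendsto u atTop (@nhds X σ x)

/-- Every convex sequentially open subset of `(X, σ)` is open. -/
def IsCSequential (σ : TopologicalSpace X) : Prop :=
  ∀ U : Set X, Convex ℝ U →
    (∀ x ∈ U, ∀ u : ℕ → X, Tendsto u atTop (@nhds X σ x) → ∀ᶠ n in atTop, u n ∈ U) →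
    IsOpen[σ] U

end Topologies

section Families

variable {X : Type*} [AddCommGroup X] [Module ℂ X]

/-- `σ`-strong continuity of a family of linear maps. -/
def StronglyContinuous {I : Type*} [TopologicalSpace I] (σ : TopologicalSpace X)
    (T : I → X →ₗ[ℂ] X) : Prop :=
  (∀ t, Continuous[σ, σ] (T t)) ∧ ∀ x, Continuous[inferInstance, σ] fun t => T t x

/-- `σ`-equicontinuity of a family of linear maps (tested on all `σ`-continuous seminorms). -/
def EquicontinuousFamily {I : Type*} (σ : TopologicalSpace X) (T : I → X →ₗ[ℂ] X) : Prop :=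
  ∀ p : Seminorm ℂ X, Continuous[σ, inferInstance] p →
    ∃ q : Seminorm ℂ X, Continuous[σ, inferInstance] q ∧
      ∃ C : ℝ, 0 ≤ C ∧ ∀ t x, p (T t x) ≤ C * q x

/-- Equicontinuity on `[0, t₀]` for every `t₀ ≥ 0`. -/
def LocallyEquicontinuous (σ : TopologicalSpace X) (T : ℝ≥0 → X →ₗ[ℂ] X) : Prop :=
  ∀ t₀ : ℝ≥0, EquicontinuousFamily σ fun t : Iic t₀ => T t

/-- The family `(e^{-ωt} T(t))_{t ≥ 0}`. -/
noncomputable def rescaled (ω : ℝ) (T : ℝ≥0 → X →ₗ[ℂ] X) (t : ℝ≥0) : X →ₗ[ℂ] X :=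
  ((Real.exp (-(ω * t)) : ℝ) : ℂ) • T t

/-- `(e^{-ωt} T(t))_{t ≥ 0}` is `σ`-equicontinuous for some `ω`. -/
def QuasiEquicontinuous (σ : TopologicalSpace X) (T : ℝ≥0 → X →ₗ[ℂ] X) : Prop :=
  ∃ ω : ℝ, EquicontinuousFamily σ (rescaled ω T)

/-- `sup_{t ∈ [0, t₀]} ‖T(t)‖ < ∞` for every `t₀ ≥ 0`. -/
def LocallyBounded (ν : Seminorm ℂ X) (T : ℝ≥0 → X →ₗ[ℂ] X) : Prop :=
  ∀ t₀ : ℝ≥0, ∃ M : ℝ, ∀ t ≤ t₀, ∀ x, ν (T t x) ≤ M * ν x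

/-- `τ`-bi-continuous semigroups: exponentially bounded semigroups with `τ`-continuous orbits
that are locally bi-equicontinuous. -/
structure IsBiContinuous (ν : Seminorm ℂ X) (τ : TopologicalSpace X)
    (T : ℝ≥0 → X →ₗ[ℂ] X) : Prop where
  map_zero : T 0 = LinearMap.id
  map_add : ∀ t s, T (t + s) = T t ∘ₗ T s
  exponentiallyBounded : ∃ M ω : ℝ, 1 ≤ M ∧ ∀ (t : ℝ≥0) x, ν (T t x) ≤ M * Real.exp (ω * t) * ν x
  orbits : ∀ x, Continuous[inferInstance, τ] fun t => T t x
  biEquicontinuous : ∀ (t₀ : ℝ≥0) (u : ℕ → X) (x : X), (∃ C : ℝ, ∀ n, ν (u n) ≤ C) →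
    Tendsto u atTop (@nhds X τ x) →
    ∀ V ∈ @nhds X τ 0, ∀ᶠ n in atTop, ∀ t ≤ t₀, T t (u n - x) ∈ V

/-- `(ν, τ)`-equitightness of a family of linear maps (tested on all `τ`-continuous seminorms). -/
def Equitight {I : Type*} (ν : Seminorm ℂ X) (τ : TopologicalSpace X)
    (T : I → X →ₗ[ℂ] X) : Prop :=
  ∀ ε : ℝ, 0 < ε → ∀ p : Seminorm ℂ X, Continuous[τ, inferInstance] p →
    ∃ q : Seminorm ℂ X, Continuous[τ, inferInstance] q ∧
      ∃ C : ℝ, 0 ≤ C ∧ ∀ t x, p (T t x) ≤ C * q x + ε * ν x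

/-- `(e^{-αt} T(t))_{t ≥ 0}` is equitight for some `α`. -/
def QuasiEquitight (ν : Seminorm ℂ X) (τ : TopologicalSpace X) (T : ℝ≥0 → X →ₗ[ℂ] X) : Prop :=
  ∃ α : ℝ, Equitight ν τ (rescaled α T)

/-- The graph of the generator of `T` with respect to `σ`:
`y = σ-lim_{t → 0+} (T(t) x - x) / t`. -/
def IsGeneratorValue (σ : TopologicalSpace X) (T : ℝ≥0 → X →ₗ[ℂ] X) (x y : X) : Prop :=
  Tendsto (fun t : ℝ≥0 => ((t : ℝ) : ℂ)⁻¹ • (T t x - x)) (𝓝[>] 0) (@nhds X σ y)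

/-- The domain of the generator of `T` with respect to `σ`. -/
def generatorDomain (σ : TopologicalSpace X) (T : ℝ≥0 → X →ₗ[ℂ] X) : Set X :=
  {x | ∃ y, IsGeneratorValue σ T x y}

/-- The space of norm-strong continuity of `T`. -/
def strongContinuitySpace (ν : Seminorm ℂ X) (T : ℝ≥0 → X →ₗ[ℂ] X) : Set X :=
  {x | Tendsto (fun t : ℝ≥0 => ν (T t x - x)) (𝓝[>] 0) (𝓝 0)}

end Families

section Flows

variable {Ω : Set ℂ}

open Classical in
/-- Extension by zero of a function on `Ω` to `ℂ`. -/
noncomputable def extendZero (f : Ω → ℂ) (z : ℂ) : ℂ := if h : z ∈ Ω then f ⟨z, h⟩ else 0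

/-- Holomorphy of a function on the open set `Ω`. -/
def IsHolomorphic (f : Ω → ℂ) : Prop := DifferentiableOn ℂ (extendZero f) Ω

/-- The complex derivative of a function on the open set `Ω`. -/
noncomputable def cderiv (f : Ω → ℂ) (z : Ω) : ℂ := deriv (extendZero f) z

/-- `u ∈ C¹[0, ∞)`, with the one-sided derivative at `0`. -/
def IsC1 (u : ℝ≥0 → ℂ) : Prop :=
  DifferentiableOn ℝ (fun s : ℝ => u s.toNNReal) (Ici 0) ∧
    ContinuousOn (derivWithin (fun s : ℝ => u s.toNNReal) (Ici 0)) (Ici 0)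

/-- The right derivative of `u` at `0`. -/
noncomputable def rightDerivZero (u : ℝ≥0 → ℂ) : ℂ :=
  derivWithin (fun s : ℝ => u s.toNNReal) (Ici 0) 0

/-- Semiflows on `Ω`. -/
structure IsSemiflow (φ : ℝ≥0 → Ω → Ω) : Prop where
  continuous : ∀ t, Continuous (φ t)
  zero : ∀ z, φ 0 z = z
  add : ∀ t s z, φ (t + s) z = φ t (φ s z)

/-- Multiplicative semicocycles for `φ`. -/
structure IsSemicocycle (m : ℝ≥0 → Ω → ℂ) (φ : ℝ≥0 → Ω → Ω) : Prop where
  continuous : ∀ t, Continuous (m t)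
  zero : ∀ z, m 0 z = 1
  add : ∀ t s z, m (t + s) z = m t z * m s (φ t z)

/-- Holomorphic `C₀`-co-semiflows `(m, φ)` on `Ω`. -/
structure IsHolomorphicC0CoSemiflow (m : ℝ≥0 → Ω → ℂ) (φ : ℝ≥0 → Ω → Ω) : Prop where
  semiflow : IsSemiflow φ
  semicocycle : IsSemicocycle m φ
  holomorphic_flow : ∀ t, IsHolomorphic fun z => (φ t z : ℂ)
  holomorphic_cocycle : ∀ t, IsHolomorphic (m t)
  c0_flow : ∀ z, Tendsto (fun t => φ t z) (𝓝[>] 0) (𝓝 z)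
  c0_cocycle : ∀ z, Tendsto (fun t => m t z) (𝓝[>] 0) (𝓝 1)

/-- `f ↦ m_t · (f ∘ φ_t)` on all functions on `Ω`. -/
def weightedComp (m : ℝ≥0 → Ω → ℂ) (φ : ℝ≥0 → Ω → Ω) (t : ℝ≥0) : (Ω → ℂ) →ₗ[ℂ] (Ω → ℂ) where
  toFun f z := m t z * f (φ t z)
  map_add' f g := by
    funext z
    simp [mul_add]
  map_smul' c f := by
    funext z
    simp [mul_left_comm]

/-- The weighted composition semigroup on a function space `F` that it leaves invariant. -/
def weightedCompSemigroup (m : ℝ≥0 → Ω → ℂ) (φ : ℝ≥0 → Ω → Ω) (F : Submodule ℂ (Ω → ℂ))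
    (h : ∀ t, ∀ f ∈ F, weightedComp m φ t f ∈ F) (t : ℝ≥0) : F →ₗ[ℂ] F :=
  (weightedComp m φ t).restrict (h t)

/-- The compact-open topology (uniform convergence on the compact subsets of `Ω`) on `F`. -/
@[reducible] noncomputable def compactOpen (F : Submodule ℂ (Ω → ℂ)) : TopologicalSpace F :=
  TopologicalSpace.induced
    (fun f : F => UniformOnFun.ofFun {K : Set Ω | IsCompact K} (f : Ω → ℂ)) inferInstance

/-- The function `φ̇₀ f' + ṁ₀ f`. -/
noncomputable def generatorExpr (m : ℝ≥0 → Ω → ℂ) (φ : ℝ≥0 → Ω → Ω) (f : Ω → ℂ) (z : Ω) : ℂ :=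
  rightDerivZero (fun t => (φ t z : ℂ)) * cderiv f z + rightDerivZero (fun t => m t z) * f z

end Flows

end Saks

/-! Everything rests on the joint continuity of (t, z) ↦ (φ_t(z), m_t(z)), which the pointwise C₀
conditions force by Baire category and local compactness (`continuous_uncurry_of_semigroup`). The
image of [0, t₀] × K under the flow is then compact, so the operators C(t), t ≤ t₀, are
τ_co-equicontinuous. Since γ and τ_co agree on norm-bounded sets, local boundedness carries this
over to γ. A locally bounded semigroup is exponentially bounded, and rescaling by one unit more than
the growth rate makes large times small in norm; this reduces the quasi-statements to bounded time
intervals.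

The generator is handled by averaging. For suitable small h the average a_h of φ_s over s ∈ [0, h]
has a_h'(z) ≠ 0, while s ↦ a_h(φ_s(z)) is a moving average, differentiable by the fundamental
theorem of calculus. Inverting a_h locally yields φ̇₀ and its holomorphy. Averages of an orbit of C
lie in F: their Riemann sums are norm-bounded and τ_co-Cauchy, hence γ-Cauchy, hence γ-convergent
(`exists_average`). If g = φ̇₀f' + ṁ₀f lies in F, then C(t)f - f = t J_t, where J_t is an average of
the orbit of g, and J_t → g in γ.

In (e) a γ-limit of convex combinations may leave a norm ball, because the norm of a pre-Saks space
need not be lower semicontinuous. A closed graph argument on ℓ¹ shows that the γ-closure of the unit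
ball is still norm-bounded (`exists_le_of_mem_closure`), which suffices for norm estimates of
averages. -/

namespace Saks

/-! ### The mixed topology of a pre-Saks space. -/

section Abstract

variable {X : Type*} [AddCommGroup X] [Module ℂ X]

theorem normTopology_eq (ν : Seminorm ℂ X) :
    normTopology ν = ν.toSeminormedAddCommGroup.toUniformSpace.toTopologicalSpace := by
  simp [normTopology, seminormTopology]

theorem isLinearTopology_normTopology (ν : Seminorm ℂ X) : IsLinearTopology (normTopology ν) := by
  rw [normTopology_eq]
  let _ := ν.toSeminormedAddCommGroup
  let _ : NormedSpace ℂ X := { norm_smul_le := fun a x => (map_smul_eq_mul ν a x).le }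
  exact ⟨inferInstance, inferInstance⟩

theorem nhds_zero_normTopology (ν : Seminorm ℂ X) :
    @nhds X (normTopology ν) 0 = comap ν (𝓝 0) := by
  rw [normTopology_eq]
  let _ := ν.toSeminormedAddCommGroup
  exact (comap_norm_nhds_zero (E := X)).symm

theorem tendsto_nhds_iff_sub {σ : TopologicalSpace X} (h : IsLinearTopology σ) {ι : Type*}
    {l : Filter ι} {u : ι → X} {x : X} :
    Tendsto u l (@nhds X σ x) ↔ Tendsto (fun i => u i - x) l (@nhds X σ 0) := by
  have := h.1
  exact tendsto_sub_nhds_zero_iff.symm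

theorem mem_nhds_iff_add {σ : TopologicalSpace X} (h : IsLinearTopology σ) {x : X} {V : Set X} :
    V ∈ @nhds X σ x ↔ (fun y => y + x) ⁻¹' V ∈ @nhds X σ 0 := by
  have := h.1
  rw [← map_add_right_nhds_zero x, mem_map]

theorem tendsto_normTopology_iff (ν : Seminorm ℂ X) {ι : Type*} {l : Filter ι} {u : ι → X}
    {x : X} :
    Tendsto u l (@nhds X (normTopology ν) x) ↔ Tendsto (fun i => ν (u i - x)) l (𝓝 0) := by
  rw [tendsto_nhds_iff_sub (isLinearTopology_normTopology ν), nhds_zero_normTopology,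
    tendsto_comap_iff]
  rfl

theorem IsLinearTopology.inf {σ σ' : TopologicalSpace X} (h : IsLinearTopology σ)
    (h' : IsLinearTopology σ') : IsLinearTopology (σ ⊓ σ') := by
  exact ⟨topologicalAddGroup_inf h.1 h'.1,
    @continuousSMul_inf ℂ X _ _ σ σ' h.2 h'.2⟩

theorem IsLinearTopology.induced {σ : TopologicalSpace X} (h : IsLinearTopology σ)
    (T : X →ₗ[ℂ] X) : IsLinearTopology (σ.induced T) := by
  have := h.1
  have := h.2
  exact ⟨topologicalAddGroup_induced T, continuousSMul_induced T⟩

variable {ν : Seminorm ℂ X} {τ : TopologicalSpace X}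

theorem IsPreSaks.mixed_mem (h : IsPreSaks ν τ) : mixedTopology ν τ ∈ mixedCandidates ν τ :=
  (isLeast_mixedTopology h).1

theorem IsPreSaks.mixed_linear (h : IsPreSaks ν τ) : IsLinearTopology (mixedTopology ν τ) :=
  h.mixed_mem.1

theorem IsPreSaks.norm_le_mixed (h : IsPreSaks ν τ) : normTopology ν ≤ mixedTopology ν τ :=
  h.mixed_mem.2.1

theorem IsPreSaks.mixed_le (h : IsPreSaks ν τ) : mixedTopology ν τ ≤ τ :=
  h.mixed_mem.2.2.1

/-- A linear topology `σ` with `ν`-continuous identity is coarser than the mixed topology if it is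
coarser than `τ` at the points of each bounded set. -/
theorem IsPreSaks.mixed_le_of_nhds (h : IsPreSaks ν τ) {σ : TopologicalSpace X}
    (hσ : IsLinearTopology σ) (hν : normTopology ν ≤ σ)
    (hτ : ∀ R : ℝ, ∀ V ∈ @nhds X σ 0, ∃ W ∈ @nhds X τ 0, ∀ x ∈ W, ν x ≤ R → x ∈ V) :
    mixedTopology ν τ ≤ σ := by
  -- The common refinement of τ and σ is a candidate, so the finest candidate refines it and hence
  -- refines σ.
  have key : τ ⊓ σ ∈ mixedCandidates ν τ := by
    refine ⟨h.linear.inf hσ, le_inf h.coarser hν, inf_le_left, ?_⟩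
    rintro B ⟨C, hC⟩
    rw [induced_inf]
    refine inf_eq_left.2 ?_
    refine le_of_nhds_le_nhds fun b => ?_
    rw [@nhds_induced _ _ τ, @nhds_induced _ _ σ]
    rintro _ ⟨V, hV, hVs⟩
    -- Differences of two points of `B` have norm at most `C + C`, so the hypothesis at zero can be
    -- translated to `b`.
    obtain ⟨W, hW, hWV⟩ := hτ (C + C) _ ((mem_nhds_iff_add hσ).1 hV)
    refine ⟨(fun x => x - b) ⁻¹' W, ?_, fun x hx => hVs ?_⟩
    · rw [mem_nhds_iff_add h.linear]
      change (fun y => y + (b : X) - b) ⁻¹' W ∈ _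
      simpa using hW
    · have := hWV _ hx ((map_sub_le_add ν _ _).trans (add_le_add (hC _ x.2) (hC _ b.2)))
      simpa using this
  exact (sInf_le key).trans inf_le_right

/-- On bounded sets, the mixed neighbourhoods of zero contain `τ`-neighbourhoods of zero. -/
theorem IsPreSaks.exists_nhds_of_mixed (h : IsPreSaks ν τ) (R : ℝ) {V : Set X}
    (hV : V ∈ @nhds X (mixedTopology ν τ) 0) : ∃ W ∈ @nhds X τ 0, ∀ x ∈ W, ν x ≤ R → x ∈ V := by
  -- The maximum keeps 0 in `B` when `R` is negative.
  set B : Set X := {x | ν x ≤ max R 0}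
  have hB := h.mixed_mem.2.2.2 B ⟨_, fun _ hx => hx⟩
  have h0 : (0 : X) ∈ B := by simp [B]
  have h1 : @nhds B ((mixedTopology ν τ).induced (↑)) ⟨0, h0⟩ = @nhds B (τ.induced (↑)) ⟨0, h0⟩ :=
    by rw [hB]
  rw [@nhds_induced _ _ τ, @nhds_induced _ _ (mixedTopology ν τ)] at h1
  have h2 : ((↑) : B → X) ⁻¹' V ∈ comap ((↑) : B → X) (@nhds X τ 0) := by
    rw [← h1]
    exact preimage_mem_comap hV
  obtain ⟨W, hW, hWV⟩ := h2
  exact ⟨W, hW, fun x hx hxR => hWV (a := ⟨x, hxR.trans (le_max_left _ _)⟩) hx⟩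

/-- The differences u_i - x stay in the ball of radius R + ν(x), where γ-neighbourhoods of zero may
be replaced by τ-neighbourhoods. -/
theorem IsPreSaks.tendsto_mixed (h : IsPreSaks ν τ) {ι : Type*} {l : Filter ι} {u : ι → X} {x : X}
    {R : ℝ} (hu : ∀ᶠ i in l, ν (u i) ≤ R) (hτ : Tendsto u l (@nhds X τ x)) :
    Tendsto u l (@nhds X (mixedTopology ν τ) x) := by
  rw [tendsto_nhds_iff_sub h.mixed_linear]
  rw [tendsto_nhds_iff_sub h.linear] at hτ
  intro V hV
  obtain ⟨W, hW, hWV⟩ := h.exists_nhds_of_mixed (R + ν x) hV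
  refine mem_map.2 ?_
  filter_upwards [hu, hτ hW] with i hi hi'
  exact hWV _ hi' ((map_sub_le_add ν _ _).trans (by gcongr))

theorem IsPreSaks.hausdorff_mixed (h : IsPreSaks ν τ) : @T2Space X (mixedTopology ν τ) :=
  @T2Space.mk X (mixedTopology ν τ) fun _ _ hxy =>
    let ⟨u, v, hu, hv, hx, hy, huv⟩ := @T2Space.t2 X τ h.hausdorff _ _ hxy
    ⟨u, v, h.mixed_le u hu, h.mixed_le v hv, hx, hy, huv⟩

/-- A seminorm is continuous for the mixed topology if it is norm-continuous and small on the
intersections of norm balls with small `τ`-neighbourhoods of zero. -/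
theorem IsPreSaks.continuous_seminorm (h : IsPreSaks ν τ) {q : Seminorm ℂ X} {C : ℝ}
    (hC : ∀ x, q x ≤ C * ν x)
    (hτ : ∀ R ε : ℝ, 0 < ε → ∃ W ∈ @nhds X τ 0, ∀ x ∈ W, ν x ≤ R → q x ≤ ε) :
    Continuous[mixedTopology ν τ, inferInstance] q := by
  have hle : mixedTopology ν τ ≤ normTopology q := by
    refine h.mixed_le_of_nhds (isLinearTopology_normTopology q) ?_ ?_
    · rw [← continuous_id_iff_le]
      have h1 := (isLinearTopology_normTopology ν).1
      have h2 := (isLinearTopology_normTopology q).1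
      refine @continuous_of_continuousAt_zero X (normTopology ν) _ h1 X _ _ (normTopology q)
        h2.toContinuousAdd _ _ (AddMonoidHom.id X) ?_
      unfold ContinuousAt
      rw [map_zero, nhds_zero_normTopology, nhds_zero_normTopology, tendsto_comap_iff]
      have : Tendsto (fun x => C * ν x) (comap ν (𝓝 0)) (𝓝 0) := by
        simpa using (tendsto_comap (f := ν) (x := 𝓝 0)).const_mul C
      exact squeeze_zero (fun x => apply_nonneg q x) hC this
    · intro R V hV
      rw [nhds_zero_normTopology] at hV
      obtain ⟨U, hU, hUV⟩ := hV
      obtain ⟨ε, hε, hεU⟩ := Metric.mem_nhds_iff.1 hU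
      obtain ⟨W, hW, hWq⟩ := hτ R (ε / 2) (by positivity)
      refine ⟨W, hW, fun x hx hxR => hUV (hεU ?_)⟩
      have := hWq x hx hxR
      rw [Metric.mem_ball, Real.dist_eq, sub_zero, abs_of_nonneg (apply_nonneg q x)]
      linarith
  refine continuous_le_dom hle ?_
  have h2 := (isLinearTopology_normTopology q).1
  refine @Seminorm.continuous_of_continuousAt_zero ℂ X _ _ _ (normTopology q) h2 q ?_
  unfold ContinuousAt
  rw [map_zero, nhds_zero_normTopology]
  exact tendsto_comap

/-- A continuous seminorm for a topology coarser than the norm topology is bounded by the norm. -/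
theorem exists_le_of_continuous {σ : TopologicalSpace X} (hσ : normTopology ν ≤ σ)
    {p : Seminorm ℂ X} (hp : Continuous[σ, inferInstance] p) :
    ∃ C, 0 ≤ C ∧ ∀ x, p x ≤ C * ν x := by
  have h1 := continuous_le_dom hσ hp
  rw [normTopology_eq] at h1
  let _ := ν.toSeminormedAddCommGroup
  let _ : NormedSpace ℂ X := { norm_smul_le := fun a x => (map_smul_eq_mul ν a x).le }
  obtain ⟨C, hC, hp⟩ := p.bound_of_continuous_normedSpace h1
  exact ⟨C, hC.le, hp⟩

/-- Uniformly norm-bounded families that are equicontinuous at zero on norm balls are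
equicontinuous for the mixed topology. -/
theorem IsPreSaks.equicontinuousFamily_mixed (h : IsPreSaks ν τ) {I : Type*} [Nonempty I]
    {S : I → X →ₗ[ℂ] X} {M : ℝ} (hM : ∀ i x, ν (S i x) ≤ M * ν x)
    (hS : ∀ p : Seminorm ℂ X, Continuous[mixedTopology ν τ, inferInstance] p →
      ∀ R ε : ℝ, 0 < ε → ∃ W ∈ @nhds X τ 0, ∀ x ∈ W, ν x ≤ R → ∀ i, p (S i x) ≤ ε) :
    EquicontinuousFamily (mixedTopology ν τ) S := by
  intro p hp
  obtain ⟨C, hC, hpC⟩ := exists_le_of_continuous h.norm_le_mixed hp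
  have hle : ∀ i x, p (S i x) ≤ C * M * ν x := fun i x => by
    rw [mul_assoc]
    exact (hpC _).trans (by gcongr; exact hM i x)
  -- A supremum of seminorms is pointwise only for a bounded family; otherwise it takes the default
  -- value 0.
  have hbdd : BddAbove (range fun i => p.comp (S i)) := by
    rw [Seminorm.bddAbove_range_iff]
    rintro x
    exact ⟨C * M * ν x, by rintro _ ⟨i, rfl⟩; exact hle i x⟩
  have happ : ∀ x, (⨆ i, p.comp (S i)) x = ⨆ i, p (S i x) := fun x => by
    rw [Seminorm.iSup_apply hbdd]
    rfl
  refine ⟨⨆ i, p.comp (S i), h.continuous_seminorm (C := C * M) ?_ ?_, 1, zero_le_one, ?_⟩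
  · intro x
    rw [happ]
    exact ciSup_le fun i => hle i x
  · intro R ε hε
    obtain ⟨W, hW, hWp⟩ := hS p hp R ε hε
    refine ⟨W, hW, fun x hx hxR => ?_⟩
    rw [happ]
    exact ciSup_le fun i => hWp x hx hxR i
  · intro i x
    rw [one_mul, happ]
    exact le_ciSup (f := fun i => p (S i x))
      ⟨C * M * ν x, by rintro _ ⟨i, rfl⟩; exact hle i x⟩ i

/-- Norm-bounded `τ`-continuous linear maps are continuous for the mixed topology. -/
theorem IsPreSaks.continuous_mixed (h : IsPreSaks ν τ) {T : X →ₗ[ℂ] X} {M : ℝ}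
    (hM : ∀ x, ν (T x) ≤ M * ν x) (hT : Continuous[τ, τ] T) :
    Continuous[mixedTopology ν τ, mixedTopology ν τ] T := by
  rw [continuous_iff_le_induced]
  refine h.mixed_le_of_nhds (h.mixed_linear.induced T) ?_ ?_
  · rw [← continuous_iff_le_induced]
    have h1 := (isLinearTopology_normTopology ν).1
    refine continuous_le_rng h.norm_le_mixed ?_
    refine @continuous_of_continuousAt_zero X (normTopology ν) _ h1 X _ _ (normTopology ν)
      h1.toContinuousAdd _ _ T ?_
    unfold ContinuousAt
    rw [map_zero, nhds_zero_normTopology, tendsto_comap_iff]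
    have : Tendsto (fun x => M * ν x) (comap ν (𝓝 0)) (𝓝 0) := by
      simpa using (tendsto_comap (f := ν) (x := 𝓝 0)).const_mul M
    exact squeeze_zero (fun x => apply_nonneg ν _) hM this
  · intro R V hV
    rw [@nhds_induced _ _ (mixedTopology ν τ), map_zero] at hV
    obtain ⟨U, hU, hUV⟩ := hV
    obtain ⟨W, hW, hWU⟩ := h.exists_nhds_of_mixed (|M| * R) hU
    refine ⟨T ⁻¹' W, ?_, fun x hx hxR => hUV (hWU _ hx ((hM x).trans ?_))⟩
    · exact hT.continuousAt.preimage_mem_nhds (by simpa using hW)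
    · exact (mul_le_mul_of_nonneg_right (le_abs_self M) (apply_nonneg ν x)).trans (by gcongr)

end Abstract

/-! ### Closures of norm balls in a coarser sequentially complete topology. -/

section BanachDisc

variable {Y X : Type*} [NormedAddCommGroup Y] [NormedSpace ℂ Y] [AddCommGroup X] [Module ℂ X]
  [TopologicalSpace X] [IsTopologicalAddGroup X] {j : Y ≃ₗ[ℂ] X}

/-- Quantitative absolute convexity of the closed ball image. The y_k are only limits of points of
the image, so the induction runs on closures through continuity of (x, z) ↦ a_k x + z. -/
theorem sum_smul_mem_closure_image_closedBall [ContinuousSMul ℂ X] {y : ℕ → X}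
    (hy : ∀ k, y k ∈ closure (j '' Metric.closedBall 0 1)) (a : ℕ → ℂ) (s : Finset ℕ) :
    ∑ k ∈ s, a k • y k ∈ closure (j '' Metric.closedBall 0 (∑ k ∈ s, ‖a k‖)) := by
  classical
  induction s using Finset.induction_on with
  | empty => exact subset_closure ⟨0, by simp, by simp⟩
  | insert k s hk ih =>
    rw [Finset.sum_insert hk, Finset.sum_insert hk]
    refine map_mem_closure₂ (f := fun x z : X => a k • x + z) (by fun_prop) (hy k) ih ?_
    rintro _ ⟨u, hu, rfl⟩ _ ⟨v, hv, rfl⟩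
    refine ⟨a k • u + v, ?_, by simp⟩
    rw [mem_closedBall_zero_iff] at *
    refine (norm_add_le _ _).trans (add_le_add ?_ hv)
    rw [norm_smul]
    exact mul_le_of_le_one_right (norm_nonneg _) hu

theorem exists_closure_image_closedBall_subset (hj : Continuous j) {V : Set X} (hV : V ∈ 𝓝 0) :
    ∃ ε > 0, closure (j '' Metric.closedBall 0 ε) ⊆ V := by
  obtain ⟨U, ⟨hU, hUc⟩, hUV⟩ := (closed_nhds_basis (0 : X)).mem_iff.1 hV
  have := hj.continuousAt.preimage_mem_nhds (x := 0) (by simpa using hU)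
  obtain ⟨ε, hε, h⟩ := Metric.nhds_basis_closedBall.mem_iff.1 this
  exact ⟨ε, hε, (closure_minimal (image_subset_iff.2 h) hUc).trans hUV⟩

/-- Blocks of the series far out lie in closures of images of arbitrarily small balls, which fit
into any neighbourhood of zero; absolute summability thus makes the partial sums Cauchy. -/
theorem exists_tendsto_sum_smul [ContinuousSMul ℂ X] (hj : Continuous j)
    (hX : ∀ u : ℕ → X, Tendsto (fun k : ℕ × ℕ => u k.1 - u k.2) atTop (𝓝 0) →
      ∃ x, Tendsto u atTop (𝓝 x)) {y : ℕ → X}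
    (hy : ∀ k, y k ∈ closure (j '' Metric.closedBall 0 1)) {a : ℕ → ℂ}
    (ha : Summable fun k => ‖a k‖) :
    ∃ x, Tendsto (fun n => ∑ k ∈ Finset.range n, a k • y k) atTop (𝓝 x) ∧
      x ∈ closure (j '' Metric.closedBall 0 (∑' k, ‖a k‖)) := by
  have hmono : ∀ {r s : ℝ}, r ≤ s →
      closure (j '' Metric.closedBall 0 r) ⊆ closure (j '' Metric.closedBall 0 s) := fun h =>
    closure_mono (image_mono (Metric.closedBall_subset_closedBall h))
  obtain ⟨x, hx⟩ := hX (fun n => ∑ k ∈ Finset.range n, a k • y k) <| by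
    intro V hV
    -- Symmetrizing allows the two indices of the Cauchy condition to come in either order.
    have hV' : V ∩ -V ∈ 𝓝 (0 : X) :=
      inter_mem hV (by simpa using neg_mem_nhds_zero X hV)
    obtain ⟨ε, hε, hεV⟩ := exists_closure_image_closedBall_subset hj hV'
    obtain ⟨N, hN⟩ := Metric.cauchySeq_iff.1 ha.hasSum.tendsto_sum_nat.cauchySeq ε hε
    have key : ∀ m ≥ N, ∀ n ≥ m,
        (∑ k ∈ Finset.range n, a k • y k) - ∑ k ∈ Finset.range m, a k • y k ∈ V ∩ -V := by
      intro m hm n hn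
      rw [← Finset.sum_Ico_eq_sub _ hn]
      refine hεV (hmono ?_ (sum_smul_mem_closure_image_closedBall hy a _))
      rw [Finset.sum_Ico_eq_sub _ hn]
      have := hN n (hm.trans hn) m hm
      rw [Real.dist_eq] at this
      exact (le_abs_self _).trans this.le
    refine mem_map.2 (mem_of_superset (Ici_mem_atTop (N, N)) ?_)
    rintro ⟨n, m⟩ ⟨hn, hm⟩
    rcases le_total m n with h | h
    · exact (key m hm n h).1
    · have := (key n hn m h).2
      rwa [Set.mem_neg, neg_sub] at this
  refine ⟨x, hx, isClosed_closure.mem_of_tendsto hx (Eventually.of_forall fun n => ?_)⟩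
  exact hmono (ha.sum_le_tsum _ fun _ _ => norm_nonneg _)
    (sum_smul_mem_closure_image_closedBall hy a _)

/-- Under a continuous linear bijection from a Banach space onto a sequentially complete Hausdorff
topological vector space, the closure of the image of the unit ball is the image of a bounded
set. -/
theorem exists_norm_le_of_mem_closure_image_closedBall [CompleteSpace Y] [ContinuousSMul ℂ X]
    [T2Space X]
    (hj : Continuous j)
    (hX : ∀ u : ℕ → X, Tendsto (fun k : ℕ × ℕ => u k.1 - u k.2) atTop (𝓝 0) →
      ∃ x, Tendsto u atTop (𝓝 x)) :
    ∃ C : ℝ, ∀ y, j y ∈ closure (j '' Metric.closedBall 0 1) → ‖y‖ ≤ C := by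
  by_contra! hcon
  choose y hy hyn using fun n : ℕ => hcon n
  have hsum : ∀ a : lp (fun _ : ℕ => ℂ) 1, Summable fun k => ‖a k‖ := fun a => by
    simpa using (lp.memℓp a).summable (by simp)
  have hnorm : ∀ a : lp (fun _ : ℕ => ℂ) 1, ∑' k, ‖a k‖ = ‖a‖ := fun a => by
    simp [lp.norm_eq_tsum_rpow (p := 1) (by simp) a]
  choose S hS hSm using fun a : lp (fun _ : ℕ => ℂ) 1 => exists_tendsto_sum_smul hj hX hy (hsum a)
  simp only [hnorm] at hSm
  -- Suppose j(y_n) lies in the closure although ‖y_n‖ > n. Then a ↦ j⁻¹(∑ a_k j(y_k)) is linear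
  -- from ℓ¹ to `Y` and sends the n-th unit vector to y_n; continuity of this map is the
  -- contradiction.
  let Θ : lp (fun _ : ℕ => ℂ) 1 →ₗ[ℂ] Y :=
    { toFun := fun a => j.symm (S a)
      map_add' := fun a b => by
        rw [← map_add]
        refine congrArg _ (tendsto_nhds_unique (hS (a + b)) ?_)
        simpa [add_smul, Finset.sum_add_distrib] using (hS a).add (hS b)
      map_smul' := fun c a => by
        rw [← map_smul]
        refine congrArg _ (tendsto_nhds_unique (hS (c • a)) ?_)
        simpa [mul_smul, Finset.smul_sum] using (hS a).const_smul c }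
  have hjΘ : ∀ a, j (Θ a) = S a := fun a => j.apply_symm_apply _
  have hcont : Continuous Θ := by
    -- The composite with `j` is continuous on ℓ¹ because its values lie in closures of images of
    -- balls of radius ‖a‖. As `X` is Hausdorff and `j` injective, the graph is closed.
    refine Θ.continuous_of_seq_closed_graph fun u a z hu hz => ?_
    have h1 : Tendsto (fun n => j (Θ (u n))) atTop (𝓝 (j z)) := (hj.tendsto z).comp hz
    have h2 : Tendsto (fun n => j (Θ (u n)) - j (Θ a)) atTop (𝓝 0) := by
      intro V hV
      obtain ⟨ε, hε, hεV⟩ := exists_closure_image_closedBall_subset hj hV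
      have h3 := Metric.tendsto_nhds.1 hu ε hε
      refine mem_map.2 (h3.mono fun n hn => hεV ?_)
      change j (Θ (u n)) - j (Θ a) ∈ _
      rw [← map_sub, ← map_sub, hjΘ]
      refine closure_mono (image_mono (Metric.closedBall_subset_closedBall ?_)) (hSm _)
      rw [← dist_eq_norm]
      exact hn.le
    exact j.injective (tendsto_nhds_unique h1 (tendsto_sub_nhds_zero_iff.1 h2))
  have hΘy : ∀ n, Θ (lp.single 1 n 1) = y n := fun n => by
    refine j.injective ((hjΘ _).trans (tendsto_nhds_unique (hS _) ?_))
    refine tendsto_const_nhds.congr' ?_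
    filter_upwards [eventually_gt_atTop n] with k hk
    rw [Finset.sum_eq_single n]
    · simp
    · intro i _ hi
      simp [hi]
    · intro h
      exact absurd (Finset.mem_range.2 hk) h
  obtain ⟨C, hC⟩ := (⟨Θ, hcont⟩ : lp (fun _ : ℕ => ℂ) 1 →L[ℂ] Y).bound
  obtain ⟨n, hn⟩ := exists_nat_gt C
  have h1 := hC.2 (lp.single 1 n 1)
  rw [lp.norm_single (by simp)] at h1
  simp only [ContinuousLinearMap.coe_mk', hΘy, norm_one, mul_one] at h1
  exact absurd (h1.trans_lt hn) (hyn n).le.not_gt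

end BanachDisc

variable {X : Type*} [AddCommGroup X] [Module ℂ X] {ν : Seminorm ℂ X}

theorem exists_le_of_mem_closure (hν : ∀ x, ν x = 0 → x = 0) {σ : TopologicalSpace X}
    (hσ : IsLinearTopology σ) (hT2 : @T2Space X σ) (hle : normTopology ν ≤ σ)
    (hseq : IsSeqComplete σ) (hcomp : IsSeqComplete (normTopology ν)) :
    ∃ C : ℝ, ∀ r, 0 < r → ∀ y ∈ @closure X σ {x | ν x ≤ r}, ν y ≤ C * r := by
  let N : AddGroupNorm X :=
    { ν.toAddGroupSeminorm with eq_zero_of_map_eq_zero' := fun x hx => hν x hx }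
  let nX : NormedAddCommGroup X := N.toNormedAddCommGroup
  let _ : NormedSpace ℂ X := { norm_smul_le := fun a x => (map_smul_eq_mul ν a x).le }
  have htop : normTopology ν = nX.toUniformSpace.toTopologicalSpace := normTopology_eq ν
  have hc : @CompleteSpace X nX.toUniformSpace := by
    refine Metric.complete_of_cauchySeq_tendsto fun u hu => ?_
    obtain ⟨x, hx⟩ := hcomp u (by
      rw [nhds_zero_normTopology, tendsto_comap_iff]
      exact (cauchySeq_iff_tendsto_dist_atTop_0.1 hu).congr fun k => dist_eq_norm _ _)
    rw [htop] at hx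
    exact ⟨x, hx⟩
  rw [htop] at hle
  obtain ⟨C, hC⟩ := @exists_norm_le_of_mem_closure_image_closedBall X X _ _ _ _ σ hσ.1
    (LinearEquiv.refl ℂ X) hc hσ.2 hT2 (continuous_id_iff_le.2 hle) hseq
  refine ⟨C, fun r hr y hy => ?_⟩
  have h1 : ((r⁻¹ : ℝ) : ℂ) • y ∈ @closure X σ {x | ν x ≤ 1} := by
    have := hσ.2
    refine @map_mem_closure X X σ σ _ _ _ _ (@continuous_const_smul ℂ X σ _ _ _) hy fun x hx => ?_
    rw [mem_ofPred_eq, map_smul_eq_mul, Complex.norm_real, Real.norm_of_nonneg (by positivity)]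
    rw [inv_mul_le_iff₀ hr]
    simpa using hx
  have hset : LinearEquiv.refl ℂ X '' Metric.closedBall 0 1 = {x | ν x ≤ 1} := by
    ext x
    simp
    rfl
  have h2 := hC (((r⁻¹ : ℝ) : ℂ) • y) (by rw [hset]; exact h1)
  change ν _ ≤ C at h2
  rw [map_smul_eq_mul, Complex.norm_real, Real.norm_of_nonneg (by positivity),
    inv_mul_le_iff₀ hr, mul_comm] at h2
  exact h2

/-- A locally bounded semigroup is exponentially bounded. -/
theorem LocallyBounded.exponentiallyBounded {T : ℝ≥0 → X →ₗ[ℂ] X} (h : LocallyBounded ν T)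
    (h0 : T 0 = LinearMap.id) (hadd : ∀ t s, T (t + s) = T t ∘ₗ T s) :
    ∃ M ω : ℝ, 1 ≤ M ∧ ∀ (t : ℝ≥0) x, ν (T t x) ≤ M * Real.exp (ω * t) * ν x := by
  obtain ⟨M', hM'⟩ := h 1
  set M := max M' 1
  have hM1 : 1 ≤ M := le_max_right _ _
  have hM : ∀ t : ℝ≥0, t ≤ 1 → ∀ x, ν (T t x) ≤ M * ν x := fun t ht x =>
    (hM' t ht x).trans (mul_le_mul_of_nonneg_right (le_max_left _ _) (apply_nonneg ν x))
  have hn : ∀ n : ℕ, ∀ x, ν (T n x) ≤ M ^ n * ν x := by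
    intro n
    induction n with
    | zero => simp [h0]
    | succ n ih =>
      intro x
      rw [Nat.cast_succ, hadd, LinearMap.comp_apply, pow_succ, mul_assoc]
      exact (ih _).trans (mul_le_mul_of_nonneg_left (hM 1 le_rfl x) (by positivity))
  -- Split t into its integer and fractional parts: the fraction costs one factor M, the integer
  -- part M^⌊t⌋ ≤ e^{t log M}, where M ≥ 1 is needed.
  refine ⟨M, Real.log M, hM1, fun t x => ?_⟩
  have hfl := Nat.floor_le (zero_le (a := t))
  have ht : t = (t - ⌊t⌋₊) + ⌊t⌋₊ := (tsub_add_cancel_of_le hfl).symm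
  have hlt : t - ⌊t⌋₊ ≤ 1 := by
    rw [tsub_le_iff_left]
    exact (Nat.lt_floor_add_one t).le
  calc ν (T t x) = ν (T (t - ⌊t⌋₊) (T ⌊t⌋₊ x)) := by
        rw [← LinearMap.comp_apply, ← hadd, ← ht]
    _ ≤ M * (M ^ ⌊t⌋₊ * ν x) := (hM _ hlt _).trans (by gcongr; exact hn _ _)
    _ = M * M ^ ⌊t⌋₊ * ν x := by ring
    _ ≤ M * Real.exp (Real.log M * t) * ν x := by
        gcongr
        rw [← Real.rpow_natCast, ← Real.rpow_def_of_pos (by linarith)]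
        exact Real.rpow_le_rpow_of_exponent_le hM1 (by exact_mod_cast hfl)


/-! ### Joint continuity of semigroups of continuous maps. -/

section Semiflow

variable {E : Type*} [MetricSpace E]

/-- Right continuity at t makes the oscillation small on the open interval just to the right of t.
Hence the open sets of small oscillation are dense, and Baire's theorem applies. -/
theorem dense_continuousAt_of_right {u : ℝ≥0 → E}
    (hu : ∀ t, ∀ ε > 0, ∃ δ > 0, ∀ s, t ≤ s → s < t + δ → dist (u s) (u t) < ε) :
    Dense {t | ContinuousAt u t} := by
  let O : ℕ → Set ℝ≥0 := fun n =>
    {t | ∃ U : Set ℝ≥0, IsOpen U ∧ t ∈ U ∧ ∀ a ∈ U, ∀ b ∈ U, dist (u a) (u b) < 1 / (n + 1 : ℝ)}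
  have hO : ∀ n, IsOpen (O n) := fun n => isOpen_iff_mem_nhds.2 fun t ⟨U, hU, ht, h⟩ =>
    mem_of_superset (hU.mem_nhds ht) fun s hs => ⟨U, hU, hs, h⟩
  have hd : ∀ n, Dense (O n) := fun n t => by
    rw [mem_closure_iff_nhds]
    intro V hV
    obtain ⟨δ, hδ, h⟩ := hu t (1 / (n + 1 : ℝ) / 2) (by positivity)
    have hV' : ∀ᶠ s in 𝓝[>] t, s ∈ V ∩ Ioo t (t + δ) :=
      inter_mem (mem_nhdsWithin_of_mem_nhds hV) (Ioo_mem_nhdsGT (lt_add_of_pos_right t hδ))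
    obtain ⟨s, hsV, hs⟩ := hV'.exists
    refine ⟨s, hsV, Ioo t (t + δ), isOpen_Ioo, hs, fun a ha b hb => ?_⟩
    calc dist (u a) (u b) ≤ dist (u a) (u t) + dist (u b) (u t) := dist_triangle_right _ _ _
      _ < 1 / (n + 1 : ℝ) / 2 + 1 / (n + 1 : ℝ) / 2 :=
        add_lt_add (h a ha.1.le ha.2) (h b hb.1.le hb.2)
      _ = _ := add_halves _
  refine (dense_iInter_of_isOpen_nat hO hd).mono fun t ht => Metric.tendsto_nhds.2 fun ε hε => ?_
  obtain ⟨n, hn⟩ := exists_nat_one_div_lt hε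
  obtain ⟨U, hU, htU, h⟩ := mem_iInter.1 ht n
  filter_upwards [hU.mem_nhds htU] with s hs
  exact (h s hs t htU).trans hn

variable {Φ : ℝ≥0 → E → E}

/-- Continuity propagates forward in time, since near t the map is Φ_{t-s} applied to its shift back
to times near s. The parameter space `W` is a point for single orbits and `E` for joint continuity.
-/
theorem continuousAt_of_lt {W : Type*} [TopologicalSpace W] (hc : ∀ t, Continuous (Φ t))
    {v : ℝ≥0 → W → E} (hadd : ∀ t s w, v (t + s) w = Φ t (v s w)) {s t : ℝ≥0} (hs : 0 < s) (hst : s < t)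
    {w : W}
    (h : ContinuousAt (fun q : ℝ≥0 × W => v q.1 q.2) (s, w)) :
    ContinuousAt (fun q : ℝ≥0 × W => v q.1 q.2) (t, w) := by
  have h1 : ContinuousAt (fun q : ℝ≥0 × W => (q.1 - (t - s), q.2)) (t, w) := by fun_prop
  have hts : t - (t - s) = s := tsub_tsub_cancel_of_le hst.le
  have h2 : ContinuousAt (fun q : ℝ≥0 × W => v (q.1 - (t - s)) q.2) (t, w) :=
    ContinuousAt.comp (g := fun q : ℝ≥0 × W => v q.1 q.2)
      (f := fun q : ℝ≥0 × W => (q.1 - (t - s), q.2)) (by simpa [hts] using h) h1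
  have h3 := (hc (t - s)).continuousAt.comp h2
  refine h3.congr ?_
  have h4 : t - s < t := tsub_lt_self (hs.trans hst) hs
  filter_upwards [continuousAt_fst.eventually (lt_mem_nhds h4)] with q hq
  rw [Function.comp_apply, ← hadd, add_tsub_cancel_of_le (le_of_lt hq)]

/-- A semigroup of continuous self-maps of a locally compact metric space whose orbits are right
continuous at zero is jointly continuous. -/
theorem continuous_uncurry_of_semigroup [LocallyCompactSpace E] (hc : ∀ t, Continuous (Φ t))
    (hz : ∀ x, Φ 0 x = x) (hadd : ∀ t s x, Φ (t + s) x = Φ t (Φ s x))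
    (h0 : ∀ x, Tendsto (fun t => Φ t x) (𝓝[>] 0) (𝓝 x)) :
    Continuous fun q : ℝ≥0 × E => Φ q.1 q.2 := by
  have hr : ∀ x, ∀ ε > 0, ∃ δ > 0, ∀ s < δ, dist (Φ s x) x < ε := fun x ε hε => by
    have h1 : ∀ᶠ t in 𝓝 (0 : ℝ≥0), t ∈ Ioi 0 → dist (Φ t x) x < ε :=
      eventually_nhdsWithin_iff.1 (Metric.tendsto_nhds.1 (h0 x) ε hε)
    obtain ⟨δ, hδ, h⟩ := (nhds_bot_basis (α := ℝ≥0)).eventually_iff.1 h1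
    refine ⟨δ, hδ, fun s hs => ?_⟩
    rcases eq_or_lt_of_le (zero_le (a := s)) with rfl | hs0
    · simpa [hz] using hε
    · exact h hs hs0
  have horb : ∀ x, Continuous fun t => Φ t x := fun x => by
    have hdense : Dense {t | ContinuousAt (fun t => Φ t x) t} := by
      refine dense_continuousAt_of_right fun t ε hε => ?_
      obtain ⟨δ, hδ, h⟩ := hr (Φ t x) ε hε
      refine ⟨δ, hδ, fun s hs hs' => ?_⟩
      have := h (s - t) (by rwa [tsub_lt_iff_left hs])
      rwa [← hadd, tsub_add_cancel_of_le hs] at this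
    refine continuous_iff_continuousAt.2 fun t => ?_
    rcases eq_or_lt_of_le (zero_le (a := t)) with rfl | ht
    · refine Metric.tendsto_nhds.2 fun ε hε => ?_
      obtain ⟨δ, hδ, h⟩ := hr x ε hε
      filter_upwards [gt_mem_nhds hδ] with s hs
      simpa [hz] using h s hs
    · obtain ⟨s, hs, hst⟩ := hdense.exists_mem_open (isOpen_Ioo (a := 0)) ⟨t / 2, by simpa using ht, by
        exact NNReal.half_lt_self ht.ne'⟩
      have h1 : ContinuousAt (fun q : ℝ≥0 × Unit => Φ q.1 x) (s, ()) :=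
        ContinuousAt.comp (g := fun t => Φ t x) (f := Prod.fst) hs continuousAt_fst
      have h2 := continuousAt_of_lt (v := fun t (_ : Unit) => Φ t x) hc (fun t s _ => hadd t s x)
        hst.1 hst.2 h1
      exact ContinuousAt.comp (g := fun q : ℝ≥0 × Unit => Φ q.1 x) (f := fun t => (t, ())) h2
        (by fun_prop)
  have hpos : ∀ t > 0, ∀ x, ContinuousAt (fun q : ℝ≥0 × E => Φ q.1 q.2) (t, x) := by
    intro t ht x
    -- The sets of times with a uniform modulus of continuity at x are closed because orbits are
    -- continuous, and they cover all times. Baire's theorem gives a time in (0, t) interior to one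
    -- of them for every n.
    let A : ℕ → ℕ → Set ℝ≥0 := fun n k =>
      {t | ∀ w ∈ Metric.ball x (1 / (k + 1 : ℝ)), dist (Φ t w) (Φ t x) ≤ 1 / (n + 1 : ℝ)}
    have hA : ∀ n k, IsClosed (A n k) := fun n k => by
      simp only [A, ofPred_forall]
      exact isClosed_iInter fun w => isClosed_iInter fun _ =>
        isClosed_le ((horb w).dist (horb x)) continuous_const
    have hU : ∀ n, ⋃ k, A n k = univ := fun n => eq_univ_of_forall fun t => by
      have h1 := Metric.tendsto_nhds.1 ((hc t).tendsto x) (1 / (n + 1 : ℝ)) (by positivity)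
      obtain ⟨δ, hδ, h⟩ := Metric.eventually_nhds_iff_ball.1 h1
      obtain ⟨k, hk⟩ := exists_nat_one_div_lt hδ
      exact mem_iUnion.2 ⟨k, fun w hw => (h w (Metric.ball_subset_ball hk.le hw)).le⟩
    have hdense : Dense (⋂ n, ⋃ k, interior (A n k)) :=
      dense_iInter_of_isOpen_nat (fun n => isOpen_iUnion fun k => isOpen_interior)
        fun n => dense_iUnion_interior_of_closed (hA n) (hU n)
    obtain ⟨s, hs, hst⟩ := hdense.exists_mem_open (isOpen_Ioo (a := 0)) ⟨t / 2, by simpa using ht, by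
        exact NNReal.half_lt_self ht.ne'⟩
    refine continuousAt_of_lt (v := Φ) hc hadd hst.1 hst.2 ?_
    refine Metric.tendsto_nhds.2 fun ε hε => ?_
    obtain ⟨n, hn⟩ := exists_nat_one_div_lt (half_pos hε)
    obtain ⟨k, hk⟩ := mem_iUnion.1 (mem_iInter.1 hs n)
    have h1 := Metric.tendsto_nhds.1 ((horb x).tendsto s) (ε / 2) (half_pos hε)
    rw [nhds_prod_eq]
    filter_upwards [prod_mem_prod (inter_mem (mem_interior_iff_mem_nhds.1 hk) h1)
      (Metric.ball_mem_nhds x (by positivity : (0 : ℝ) < 1 / (k + 1 : ℝ)))]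
    rintro ⟨t', w⟩ ⟨⟨ht', ht''⟩, hw⟩
    calc dist (Φ t' w) (Φ s x) ≤ dist (Φ t' w) (Φ t' x) + dist (Φ t' x) (Φ s x) :=
          dist_triangle _ _ _
      _ < ε / 2 + ε / 2 := add_lt_add ((ht' w hw).trans_lt hn) ht''
      _ = ε := add_halves ε
  refine continuous_iff_continuousAt.2 fun ⟨t, x⟩ => ?_
  rcases eq_or_lt_of_le (zero_le (a := t)) with rfl | ht
  swap
  · exact hpos t ht x
  -- At time 0 nothing can be propagated from earlier times. If continuity fails, nearby orbits
  -- leave a small compact ball in arbitrarily short time, and by the intermediate value theorem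
  -- they meet its sphere.
  by_contra hcon
  obtain ⟨r, hr0, hrc⟩ := Metric.exists_isCompact_closedBall x
  have hcon' : ∃ ε > 0, IsCompact (Metric.closedBall x ε) ∧
      ∃ᶠ q in 𝓝 ((0 : ℝ≥0), x), ε ≤ dist (Φ q.1 q.2) x := by
    unfold ContinuousAt at hcon
    rw [Metric.tendsto_nhds] at hcon
    push Not at hcon
    obtain ⟨ε, hε, h⟩ := hcon
    refine ⟨min ε r, lt_min hε hr0,
      hrc.of_isClosed_subset Metric.isClosed_closedBall
        (Metric.closedBall_subset_closedBall (min_le_right _ _)), ?_⟩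
    refine h.mono fun q hq => ?_
    simp only [hz] at hq
    exact (min_le_left _ _).trans hq
  obtain ⟨ε, hε, hK, hf⟩ := hcon'
  have hseq : ∀ n : ℕ, ∃ s : ℝ≥0, ∃ w, s < 1 / (n + 1 : ℝ≥0) ∧ dist w x < 1 / (n + 1 : ℝ) ∧
      dist (Φ s w) x = ε := by
    intro n
    have h1 : Iio (1 / (n + 1 : ℝ≥0)) ×ˢ Metric.ball x (min ε (1 / (n + 1 : ℝ))) ∈
        𝓝 ((0 : ℝ≥0), x) :=
      prod_mem_nhds (Iio_mem_nhds (by positivity)) (Metric.ball_mem_nhds x (by positivity))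
    obtain ⟨⟨t, w⟩, hq, ht, hw⟩ := (hf.and_eventually h1).exists
    have hw' := lt_min_iff.1 (Metric.mem_ball.1 hw)
    have hivt := intermediate_value_Icc (zero_le (a := t))
      (((horb w).dist continuous_const).continuousOn (s := Icc 0 t) (f := fun s => dist (Φ s w) x))
    obtain ⟨s, hs, hse⟩ := hivt ⟨by simpa [hz] using hw'.1.le, hq⟩
    exact ⟨s, w, hs.2.trans_lt ht, hw'.2, hse⟩
  choose s w hs hw hsw using hseq
  obtain ⟨y, hy, κ, hκ, hlim⟩ := hK.tendsto_subseq
    (x := fun n => Φ (s n) (w n)) fun n => (hsw n).le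
  have hs0 : Tendsto s atTop (𝓝 0) := by
    refine tendsto_of_tendsto_of_tendsto_of_le_of_le tendsto_const_nhds
      tendsto_one_div_add_atTop_nhds_zero_nat (fun _ => zero_le) fun n => (hs n).le
  have hw0 : Tendsto w atTop (𝓝 x) :=
    tendsto_iff_dist_tendsto_zero.2 (squeeze_zero (fun _ => dist_nonneg) (fun n => (hw n).le)
      tendsto_one_div_add_atTop_nhds_zero_nat)
  -- The limit point y of these sphere points satisfies Φ_t(y) = lim Φ_{t+s_k}(w_k) = Φ_t(x), by
  -- joint continuity at positive times. Letting t → 0 forces y = x, although y has distance ε from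
  -- x.
  have heq : ∀ t > 0, Φ t y = Φ t x := fun t ht => by
    have h1 : Tendsto (fun k => Φ t (Φ (s (κ k)) (w (κ k)))) atTop (𝓝 (Φ t y)) :=
      ((hc t).tendsto y).comp hlim
    have h2 : Tendsto (fun k => (t + s (κ k), w (κ k))) atTop (𝓝 (t, x)) := by
      have := (tendsto_const_nhds (x := t)).add (hs0.comp hκ.tendsto_atTop)
      rw [add_zero] at this
      exact this.prodMk_nhds (hw0.comp hκ.tendsto_atTop)
    have h3 := (hpos t ht x).tendsto.comp h2
    refine tendsto_nhds_unique h1 (h3.congr fun k => ?_)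
    exact hadd _ _ _
  have hyx : y = x := by
    refine tendsto_nhds_unique (h0 y) ((h0 x).congr' ?_)
    filter_upwards [self_mem_nhdsWithin] with t ht
    exact (heq t ht).symm
  have h5 : Tendsto (fun k => dist (Φ (s (κ k)) (w (κ k))) x) atTop (𝓝 (dist y x)) :=
    hlim.dist tendsto_const_nhds
  simp only [hsw] at h5
  have := tendsto_nhds_unique h5 tendsto_const_nhds
  rw [hyx, dist_self] at this
  exact hε.ne this

end Semiflow

/-! ### Riemann sums and averages of curves of functions. -/

theorem tendsto_riemannSum {E : Type*} [NormedAddCommGroup E] [NormedSpace ℝ E] [CompleteSpace E]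
    {c : ℝ → E} (hc : Continuous c) :
    Tendsto (fun n : ℕ => ∑ i ∈ Finset.range (n + 1), (n + 1 : ℝ)⁻¹ • c (i / (n + 1)))
      atTop (𝓝 (∫ σ in (0 : ℝ)..1, c σ)) := by
  refine Metric.tendsto_nhds.2 fun ε hε => ?_
  have huc := isCompact_Icc.uniformContinuousOn_of_continuous (hc.continuousOn (s := Icc 0 1))
  obtain ⟨δ, hδ, h⟩ := Metric.uniformContinuousOn_iff.1 huc (ε / 2) (half_pos hε)
  obtain ⟨N, hN⟩ := exists_nat_one_div_lt hδ
  filter_upwards [eventually_ge_atTop N] with n hn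
  have hn0 : (0 : ℝ) < n + 1 := by positivity
  set a : ℕ → ℝ := fun i => i / (n + 1)
  have hstep : ∀ i, a (i + 1) - a i = (n + 1 : ℝ)⁻¹ := fun i => by
    simp only [a]
    push_cast
    field_simp
    ring
  have hle : ∀ i, a i ≤ a (i + 1) := fun i => by
    have := hstep i
    have h2 : (0 : ℝ) < (n + 1 : ℝ)⁻¹ := by positivity
    linarith
  have hint : ∫ σ in (0 : ℝ)..1, c σ =
      ∑ i ∈ Finset.range (n + 1), ∫ σ in a i..a (i + 1), c σ := by
    rw [intervalIntegral.sum_integral_adjacent_intervals fun k _ => hc.intervalIntegrable _ _]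
    simp [a, hn0.ne']
  rw [hint, dist_eq_norm, ← Finset.sum_sub_distrib]
  refine (norm_sum_le _ _).trans_lt ?_
  have hterm : ∀ i ∈ Finset.range (n + 1),
      ‖(n + 1 : ℝ)⁻¹ • c (i / (n + 1)) - ∫ σ in a i..a (i + 1), c σ‖ ≤
        ε / 2 * (n + 1 : ℝ)⁻¹ := by
    intro i hi
    have h1 : (n + 1 : ℝ)⁻¹ • c (i / (n + 1)) = ∫ σ in a i..a (i + 1), c (a i) := by
      rw [intervalIntegral.integral_const, hstep]
    rw [h1, ← intervalIntegral.integral_sub (by simp) (hc.intervalIntegrable _ _), ← hstep i,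
      ← abs_of_nonneg (sub_nonneg.2 (hle i))]
    refine intervalIntegral.norm_integral_le_of_norm_le_const fun σ hσ => ?_
    rw [uIoc_of_le (hle i)] at hσ
    have hi' : (i : ℝ) + 1 ≤ n + 1 := by exact_mod_cast Finset.mem_range.1 hi
    have ha0 : 0 ≤ a i := by positivity
    have ha1 : a (i + 1) ≤ 1 := by
      simp only [a]
      push_cast
      rwa [div_le_one hn0]
    rw [← dist_eq_norm]
    refine (h _ ⟨ha0, (hle i).trans ha1⟩ _ ⟨ha0.trans hσ.1.le, hσ.2.trans ha1⟩ ?_).le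
    rw [Real.dist_eq, abs_sub_comm, abs_of_pos (sub_pos.2 hσ.1)]
    calc σ - a i ≤ a (i + 1) - a i := by linarith [hσ.2]
      _ = 1 / (n + 1 : ℝ) := by rw [hstep, one_div]
      _ ≤ 1 / (N + 1 : ℝ) := by gcongr
      _ < δ := hN
  refine (Finset.sum_le_sum hterm).trans_lt ?_
  rw [Finset.sum_const, Finset.card_range, nsmul_eq_mul]
  push_cast
  field_simp
  linarith

/-- The average of the curve `s ↦ h s z` over `[0, t]`. -/
noncomputable def average {W : Type*} (h : ℝ≥0 → W → ℂ) (t : ℝ≥0) (z : W) : ℂ :=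
  ∫ σ in (0 : ℝ)..1, h (t * σ.toNNReal) z

/-- The Riemann sums of `average`. -/
noncomputable def riemannSum {W : Type*} (h : ℝ≥0 → W → ℂ) (t : ℝ≥0) (n : ℕ) (z : W) : ℂ :=
  ∑ i ∈ Finset.range (n + 1), (n + 1 : ℝ)⁻¹ • h (t * ((i : ℝ≥0) / (n + 1))) z

section Average

theorem norm_average_sub_le {W : Type*} {h : ℝ≥0 → W → ℂ} {w : ℂ} {t : ℝ≥0} {z : W} {r : ℝ}
    (hr : ∀ s ≤ t, ‖h s z - w‖ ≤ r) (hh : Continuous fun s => h s z) :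
    ‖average h t z - w‖ ≤ r := by
  have hc : Continuous fun σ : ℝ => h (t * σ.toNNReal) z :=
    hh.comp (continuous_const.mul continuous_real_toNNReal)
  have h1 : average h t z - w = ∫ σ in (0 : ℝ)..1, (h (t * σ.toNNReal) z - w) := by
    rw [intervalIntegral.integral_sub (hc.intervalIntegrable _ _) (by simp)]
    simp [average]
  rw [h1]
  refine (intervalIntegral.norm_integral_le_of_norm_le_const (C := r) fun σ hσ => ?_).trans
    (by simp)
  rw [uIoc_of_le zero_le_one] at hσ
  refine hr _ (mul_le_of_le_one_right zero_le ?_)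
  simpa using hσ.2

variable {W : Type*} [TopologicalSpace W] {h : ℝ≥0 → W → ℂ}

/-- Currying turns a jointly continuous function into a curve in C(K, ℂ). For compact K, integration
in that Banach space yields convergence uniformly on K. -/
theorem exists_continuous_restrict (hh : Continuous fun q : ℝ≥0 × W => h q.1 q.2) (K : Set W) :
    ∃ c : ℝ≥0 → C(K, ℂ), Continuous c ∧ ∀ t z, c t z = h t z := by
  let f : C(ℝ≥0 × K, ℂ) := ⟨fun q => h q.1 q.2, hh.comp (f := fun q : ℝ≥0 × K => (q.1, (q.2 : W))) (by fun_prop)⟩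
  exact ⟨f.curry, f.curry.continuous, fun _ _ => rfl⟩

theorem tendstoUniformlyOn_riemannSum (hh : Continuous fun q : ℝ≥0 × W => h q.1 q.2) (t : ℝ≥0)
    {K : Set W} (hK : IsCompact K) :
    TendstoUniformlyOn (fun n => riemannSum h t n) (average h t) atTop K := by
  have := isCompact_iff_compactSpace.1 hK
  obtain ⟨c, hc, hch⟩ := exists_continuous_restrict hh K
  have hc' : Continuous fun σ : ℝ => c (t * σ.toNNReal) :=
    hc.comp (continuous_const.mul continuous_real_toNNReal)
  have hlim := tendsto_riemannSum hc'
  rw [ContinuousMap.tendsto_iff_tendstoUniformly, Metric.tendstoUniformly_iff] at hlim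
  rw [Metric.tendstoUniformlyOn_iff]
  intro ε hε
  filter_upwards [hlim ε hε] with n hn z hz
  have h1 : (∫ σ in (0 : ℝ)..1, c (t * σ.toNNReal)) ⟨z, hz⟩ = average h t z := by
    have := (ContinuousMap.evalCLM ℝ (⟨z, hz⟩ : K)).intervalIntegral_comp_comm
      (hc'.intervalIntegrable (μ := MeasureTheory.volume) 0 1)
    simp only [ContinuousMap.evalCLM_apply] at this
    rw [← this]
    simp [average, hch]
  have h2 : (∑ i ∈ Finset.range (n + 1), (n + 1 : ℝ)⁻¹ •
      c (t * ((i : ℝ) / (n + 1)).toNNReal)) ⟨z, hz⟩ = riemannSum h t n z := by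
    simp only [riemannSum, ContinuousMap.coe_sum, Finset.sum_apply, ContinuousMap.coe_smul,
      Pi.smul_apply, hch]
    refine Finset.sum_congr rfl fun i _ => ?_
    congr 3
    rw [Real.toNNReal_div (by positivity), Real.toNNReal_natCast,
      Real.toNNReal_add (by positivity) zero_le_one]
    simp
  rw [← h1, ← h2]
  exact hn ⟨z, hz⟩

theorem tendstoUniformlyOn_average (hh : Continuous fun q : ℝ≥0 × W => h q.1 q.2) {K : Set W}
    (hK : IsCompact K) : TendstoUniformlyOn (average h) (h 0) (𝓝 0) K := by
  have := isCompact_iff_compactSpace.1 hK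
  obtain ⟨c, hc, hch⟩ := exists_continuous_restrict hh K
  rw [Metric.tendstoUniformlyOn_iff]
  intro ε hε
  obtain ⟨δ, hδ, hcδ⟩ := (nhds_bot_basis (α := ℝ≥0)).eventually_iff.1
    (Metric.tendsto_nhds.1 (hc.tendsto 0) (ε / 2) (half_pos hε))
  filter_upwards [gt_mem_nhds hδ] with t ht z hz
  rw [dist_comm, dist_eq_norm]
  refine (norm_average_sub_le (r := ε / 2) (fun s hs => ?_)
    (hh.comp (f := fun s : ℝ≥0 => (s, z)) (by fun_prop))).trans_lt (half_lt_self hε)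
  rw [← hch s ⟨z, hz⟩, ← hch 0 ⟨z, hz⟩, ← dist_eq_norm]
  exact (ContinuousMap.dist_apply_le_dist _).trans (hcδ (hs.trans_lt ht)).le

end Average

/-! ### One-sided derivatives and the fundamental theorem of calculus. -/

section RightDerivative

/-- `d` is the right derivative of `u` at zero. -/
def HasRightDeriv (u : ℝ≥0 → ℂ) (d : ℂ) : Prop :=
  HasDerivWithinAt (fun s : ℝ => u s.toNNReal) d (Ici 0) 0

variable {u v : ℝ≥0 → ℂ} {d : ℂ}

theorem HasRightDeriv.rightDerivZero_eq (hu : HasRightDeriv u d) : rightDerivZero u = d :=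
  HasDerivWithinAt.derivWithin hu (uniqueDiffOn_Ici 0 0 self_mem_Ici)

theorem IsC1.hasRightDeriv (hu : IsC1 u) : HasRightDeriv u (rightDerivZero u) :=
  (hu.1 0 self_mem_Ici).hasDerivWithinAt

theorem HasRightDeriv.tendsto (hu : HasRightDeriv u d) :
    Tendsto (fun t : ℝ≥0 => ((t : ℝ) : ℂ)⁻¹ * (u t - u 0)) (𝓝[>] 0) (𝓝 d) := by
  have h1 := hasDerivWithinAt_iff_tendsto_slope.1 hu
  have h2 : Tendsto ((↑) : ℝ≥0 → ℝ) (𝓝[>] 0) (𝓝[Ici 0 \ {0}] 0) := by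
    refine tendsto_nhdsWithin_iff.2
      ⟨(NNReal.continuous_coe.tendsto' 0 0 NNReal.coe_zero).mono_left nhdsWithin_le_nhds, ?_⟩
    filter_upwards [self_mem_nhdsWithin] with t ht
    exact ⟨t.2, fun h => ne_of_gt ht (NNReal.coe_eq_zero.1 h)⟩
  refine (h1.comp h2).congr fun t => ?_
  simp [slope_def_module]

/-- The right derivative at zero of a moving average. -/
theorem hasRightDeriv_average (hu : Continuous u) {h : ℝ≥0} (hh : h ≠ 0) :
    HasRightDeriv (fun s => ∫ σ in (0 : ℝ)..1, u (h * σ.toNNReal + s))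
      ((h : ℂ)⁻¹ * (u h - u 0)) := by
  have hU : Continuous fun r : ℝ => u r.toNNReal := hu.comp continuous_real_toNNReal
  have hh' : (h : ℝ) ≠ 0 := by simpa using hh
  -- For s ≥ 0 the moving average equals (P(s + h) - P(s)) / h.
  set P : ℝ → ℂ := fun s => ∫ r in (0 : ℝ)..s, u r.toNNReal
  have hP : ∀ s, HasDerivAt P (u s.toNNReal) s := fun s => hU.integral_hasStrictDerivAt 0 s
    |>.hasDerivAt
  have h1 : HasDerivAt (fun s => (h : ℂ)⁻¹ * (P (s + h) - P s)) ((h : ℂ)⁻¹ * (u h - u 0)) 0 := by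
    have h2 := ((hP (0 + h)).comp_add_const 0 (h : ℝ)).sub (hP 0)
    simpa using h2.const_mul ((h : ℂ)⁻¹)
  refine h1.hasDerivWithinAt.congr_of_mem (fun s hs => ?_) self_mem_Ici
  have h3 : ∫ σ in (0 : ℝ)..1, u (h * σ.toNNReal + s.toNNReal) =
      ∫ σ in (0 : ℝ)..1, u (s + h * σ).toNNReal := by
    refine intervalIntegral.integral_congr fun σ hσ => ?_
    rw [uIcc_of_le zero_le_one] at hσ
    rw [Real.toNNReal_add hs (mul_nonneg h.coe_nonneg hσ.1), Real.toNNReal_mul h.coe_nonneg,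
      Real.toNNReal_coe, add_comm]
  have h4 : P (s + h) - P s = ∫ r in s..s + h, u r.toNNReal :=
    intervalIntegral.integral_interval_sub_left (hU.intervalIntegrable _ _)
      (hU.intervalIntegrable _ _)
  dsimp only
  rw [h3, intervalIntegral.integral_comp_add_mul (fun r => u r.toNNReal) hh', h4,
    Complex.real_smul]
  simp

/-- Continuous functions with a continuous right derivative are integrals of it. -/
theorem eq_add_integral_of_hasRightDeriv (hu : Continuous u) (hv : Continuous v)
    (huv : ∀ t, HasRightDeriv (fun s => u (t + s)) (v t)) {s : ℝ} (hs : 0 ≤ s) :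
    u s.toNNReal = u 0 + ∫ r in (0 : ℝ)..s, v r.toNNReal := by
  have hU : Continuous fun r : ℝ => u r.toNNReal := hu.comp continuous_real_toNNReal
  have hV : Continuous fun r : ℝ => v r.toNNReal := hv.comp continuous_real_toNNReal
  have hP : ∀ s, HasDerivAt (fun s => ∫ r in (0 : ℝ)..s, v r.toNNReal) (v s.toNNReal) s :=
    fun s => (hV.integral_hasStrictDerivAt 0 s).hasDerivAt
  -- The difference between u and the integral of v has right derivative zero everywhere, so it is
  -- constant.
  have key := constant_of_has_deriv_right_zero
    (f := fun s : ℝ => u s.toNNReal - ∫ r in (0 : ℝ)..s, v r.toNNReal) (a := 0) (b := s)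
    (hU.sub (continuous_iff_continuousAt.2 fun s => (hP s).continuousAt)).continuousOn ?_ s
    (right_mem_Icc.2 hs)
  · simp only [Real.toNNReal_zero, intervalIntegral.integral_same, sub_zero] at key
    rw [← key]
    ring
  · intro x hx
    have h1 : HasDerivWithinAt (fun s : ℝ => u s.toNNReal) (v x.toNNReal) (Ici x) x := by
      have h2 : HasDerivWithinAt (fun s : ℝ => s - x) 1 (Ici x) x :=
        ((hasDerivAt_id x).sub_const x).hasDerivWithinAt
      have h3 := huv x.toNNReal
      unfold HasRightDeriv at h3
      rw [← sub_self x] at h3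
      have h4 := h3.scomp (h := fun s : ℝ => s - x) x h2
        (fun s hs => by simpa using hs)
      rw [one_smul] at h4
      refine h4.congr_of_mem (fun s hs => ?_) self_mem_Ici
      simp only [Function.comp_apply]
      rw [← Real.toNNReal_add hx.1 (sub_nonneg.2 hs), add_sub_cancel]
    have h5 := h1.sub (hP x).hasDerivWithinAt
    rwa [sub_self] at h5

theorem isC1_of_hasRightDeriv (hu : Continuous u) (hv : Continuous v)
    (huv : ∀ t, HasRightDeriv (fun s => u (t + s)) (v t)) : IsC1 u := by
  have hV : Continuous fun r : ℝ => v r.toNNReal := hv.comp continuous_real_toNNReal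
  have hd : ∀ s ∈ Ici (0 : ℝ),
      HasDerivWithinAt (fun s : ℝ => u s.toNNReal) (v s.toNNReal) (Ici 0) s := fun s hs => by
    have h1 := ((hV.integral_hasStrictDerivAt 0 s).hasDerivAt.const_add (u 0)).hasDerivWithinAt
      (s := Ici 0)
    exact h1.congr_of_mem (fun r hr => eq_add_integral_of_hasRightDeriv hu hv huv hr) hs
  refine ⟨fun s hs => (hd s hs).differentiableWithinAt, hV.continuousOn.congr fun s hs => ?_⟩
  exact (hd s hs).derivWithin (uniqueDiffOn_Ici 0 s hs)

theorem sub_eq_mul_average (hu : Continuous u) (hv : Continuous v)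
    (huv : ∀ t, HasRightDeriv (fun s => u (t + s)) (v t)) (t : ℝ≥0) :
    u t - u 0 = ((t : ℝ) : ℂ) * ∫ σ in (0 : ℝ)..1, v (t * σ.toNNReal) := by
  have h1 := eq_add_integral_of_hasRightDeriv hu hv huv t.2
  have h2 : ∫ σ in (0 : ℝ)..1, v (t * σ.toNNReal) =
      ∫ σ in (0 : ℝ)..1, v ((t : ℝ) * σ).toNNReal := by
    congr 1
    ext σ
    rw [Real.toNNReal_mul t.coe_nonneg, Real.toNNReal_coe]
  have h3 := intervalIntegral.smul_integral_comp_mul_left (a := 0) (b := 1)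
    (fun r => v r.toNNReal) (t : ℝ)
  rw [mul_zero, mul_one] at h3
  rw [h2, ← Complex.real_smul, h3]
  change u (Real.toNNReal t) = _ + ∫ r in (0 : ℝ)..(t : ℝ), _ at h1
  rw [Real.toNNReal_coe] at h1
  rw [h1]
  ring

end RightDerivative

/-! ### Holomorphy of averages and local inversion. -/

section Holomorphic

variable {Ω : Set ℂ}

theorem extendZero_coe (f : Ω → ℂ) (z : Ω) : extendZero f z = f z := by
  simp [extendZero]

theorem IsHolomorphic.continuous {f : Ω → ℂ} (hf : IsHolomorphic f) : Continuous f :=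
  (continuousOn_iff_continuous_domRestrict.1 hf.continuousOn).congr fun z => extendZero_coe f z

theorem IsHolomorphic.hasDerivAt (hΩ : IsOpen Ω) {f : Ω → ℂ} (hf : IsHolomorphic f) (z : Ω) :
    HasDerivAt (extendZero f) (cderiv f z) z :=
  (hf.differentiableAt (hΩ.mem_nhds z.2)).hasDerivAt

theorem tendstoLocallyUniformlyOn_extendZero (hΩ : IsOpen Ω) {ι : Type*} {l : Filter ι}
    {u : ι → Ω → ℂ} {f : Ω → ℂ} (h : ∀ K, IsCompact K → TendstoUniformlyOn u f l K) :
    TendstoLocallyUniformlyOn (fun i => extendZero (u i)) (extendZero f) l Ω := by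
  rw [tendstoLocallyUniformlyOn_iff_forall_isCompact hΩ]
  intro K hKΩ hK
  have hK' : IsCompact (((↑) : Ω → ℂ) ⁻¹' K) :=
    (Topology.IsInducing.subtypeVal.isCompact_preimage_iff (by simpa using hKΩ)).2 hK
  have := h _ hK'
  rw [Metric.tendstoUniformlyOn_iff] at *
  intro ε hε
  filter_upwards [this ε hε] with i hi z hz
  simpa [← extendZero_coe] using hi ⟨z, hKΩ hz⟩ hz

theorem IsHolomorphic.sum_smul {ι : Type*} (s : Finset ι) (c : ℝ) {u : ι → Ω → ℂ}
    (hu : ∀ i, IsHolomorphic (u i)) : IsHolomorphic fun z => ∑ i ∈ s, c • u i z := by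
  have h : DifferentiableOn ℂ (fun z => ∑ i ∈ s, (c : ℂ) * extendZero (u i) z) Ω :=
    DifferentiableOn.fun_sum fun i _ => (hu i).const_mul _
  refine h.congr fun z hz => ?_
  rw [extendZero_coe _ ⟨z, hz⟩]
  refine Finset.sum_congr rfl fun i _ => ?_
  rw [extendZero_coe _ ⟨z, hz⟩, Complex.real_smul]

theorem isHolomorphic_average (hΩ : IsOpen Ω) {h : ℝ≥0 → Ω → ℂ}
    (hh : Continuous fun q : ℝ≥0 × Ω => h q.1 q.2) (hol : ∀ t, IsHolomorphic (h t)) (t : ℝ≥0) :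
    IsHolomorphic (average h t) :=
  (tendstoLocallyUniformlyOn_extendZero hΩ fun _ hK =>
    tendstoUniformlyOn_riemannSum hh t hK).differentiableOn
      (Eventually.of_forall fun _ => IsHolomorphic.sum_smul _ _ fun _ => hol _) hΩ

/-- Locally uniform convergence of holomorphic functions passes to derivatives. -/
theorem tendsto_cderiv_average (hΩ : IsOpen Ω) {h : ℝ≥0 → Ω → ℂ}
    (hh : Continuous fun q : ℝ≥0 × Ω => h q.1 q.2) (hol : ∀ t, IsHolomorphic (h t)) (z : Ω) :
    Tendsto (fun t => cderiv (average h t) z) (𝓝 0) (𝓝 (cderiv (h 0) z)) :=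
  ((tendstoLocallyUniformlyOn_extendZero hΩ fun _ hK => tendstoUniformlyOn_average hh hK).deriv
    (Eventually.of_forall fun t => isHolomorphic_average hΩ hh hol t) hΩ).tendsto_at z.2

/-- If `g ∘ u` has a right derivative and `g` is locally invertible, then `u` has a right
derivative. -/
theorem HasRightDeriv.of_comp {g : ℂ → ℂ} {u : ℝ≥0 → ℂ} {c d : ℂ} (hu : Continuous u)
    (hg : HasStrictDerivAt g c (u 0)) (hc : c ≠ 0) (hgu : HasRightDeriv (fun s => g (u s)) d) :
    HasRightDeriv u (c⁻¹ * d) := by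
  have h1 : HasDerivAt (hg.localInverse g c (u 0) hc) c⁻¹ (g (u 0)) :=
    (hg.to_localInverse hc).hasDerivAt
  have h2 : HasDerivWithinAt (fun s : ℝ => g (u s.toNNReal)) d (Ici 0) 0 := hgu
  have h3 := HasDerivAt.comp_hasDerivWithinAt (h₂ := hg.localInverse g c (u 0) hc) (0 : ℝ)
    (by simpa using h1) h2
  have h4 : ∀ᶠ s : ℝ in 𝓝 0, hg.localInverse g c (u 0) hc (g (u s.toNNReal)) = u s.toNNReal :=
    ((hu.comp continuous_real_toNNReal).tendsto' 0 (u 0) (by simp)).eventually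
      (hg.hasStrictFDerivAt_equiv hc).eventually_left_inverse
  exact h3.congr_of_eventuallyEq_of_mem
    (eventually_nhdsWithin_of_eventually_nhds (h4.mono fun s hs => hs.symm)) self_mem_Ici

end Holomorphic

/-! ### Regularity of the flow and the cocycle. -/

section Flow

variable {Ω : Set ℂ} {m : ℝ≥0 → Ω → ℂ} {φ : ℝ≥0 → Ω → Ω}

/-- The cocycle identity says exactly that (z, w) ↦ (φ_t(z), m_t(z) w) is a semigroup on Ω × ℂ. One
application of the joint continuity theorem then covers both families; setting w = 1 recovers m. -/
theorem IsHolomorphicC0CoSemiflow.continuous_prod (hmφ : IsHolomorphicC0CoSemiflow m φ)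
    (hΩ : IsOpen Ω) :
    Continuous fun q : ℝ≥0 × Ω × ℂ => (φ q.1 q.2.1, m q.1 q.2.1 * q.2.2) := by
  have := hΩ.locallyCompactSpace
  refine continuous_uncurry_of_semigroup
    (Φ := fun t (p : Ω × ℂ) => (φ t p.1, m t p.1 * p.2)) ?_ ?_ ?_ ?_
  · intro t
    have h1 := hmφ.semiflow.continuous t
    have h2 := hmφ.semicocycle.continuous t
    fun_prop
  · rintro ⟨z, w⟩
    simp [hmφ.semiflow.zero, hmφ.semicocycle.zero]
  · rintro t s ⟨z, w⟩
    have := hmφ.semicocycle.add s t z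
    rw [add_comm] at this
    simp only [hmφ.semiflow.add, this, Prod.mk.injEq, true_and]
    ring
  · rintro ⟨z, w⟩
    refine (hmφ.c0_flow z).prodMk_nhds ?_
    simpa using (hmφ.c0_cocycle z).mul_const w

theorem IsHolomorphicC0CoSemiflow.continuous_flow (hmφ : IsHolomorphicC0CoSemiflow m φ)
    (hΩ : IsOpen Ω) : Continuous fun q : ℝ≥0 × Ω => φ q.1 q.2 :=
  (hmφ.continuous_prod hΩ).fst.comp
    (f := fun q : ℝ≥0 × Ω => ((q.1, q.2, 1) : ℝ≥0 × Ω × ℂ)) (by fun_prop)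

theorem IsHolomorphicC0CoSemiflow.continuous_cocycle (hmφ : IsHolomorphicC0CoSemiflow m φ)
    (hΩ : IsOpen Ω) : Continuous fun q : ℝ≥0 × Ω => m q.1 q.2 := by
  simpa [Function.comp_def] using (hmφ.continuous_prod hΩ).snd.comp
    (f := fun q : ℝ≥0 × Ω => ((q.1, q.2, 1) : ℝ≥0 × Ω × ℂ)) (by fun_prop)

theorem IsHolomorphicC0CoSemiflow.continuous_weightedComp (hmφ : IsHolomorphicC0CoSemiflow m φ)
    (hΩ : IsOpen Ω) {f : Ω → ℂ} (hf : Continuous f) :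
    Continuous fun q : ℝ≥0 × Ω => weightedComp m φ q.1 f q.2 :=
  (hmφ.continuous_cocycle hΩ).mul (hf.comp (hmφ.continuous_flow hΩ))

/-- By the semigroup law the average a_h at φ_s(z) is a moving average of the orbit of z, hence
right differentiable in s; the local inverse of a_h at z transfers this to the orbit. -/
theorem IsHolomorphicC0CoSemiflow.hasRightDeriv_flow_of_ne_zero
    (hmφ : IsHolomorphicC0CoSemiflow m φ) (hΩ : IsOpen Ω) {h : ℝ≥0} (hh : h ≠ 0) {z : Ω}
    (hz : cderiv (average (fun t z => (φ t z : ℂ)) h) z ≠ 0) :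
    HasRightDeriv (fun t => (φ t z : ℂ))
      ((cderiv (average (fun t z => (φ t z : ℂ)) h) z)⁻¹ * ((h : ℂ)⁻¹ * (φ h z - z))) := by
  have hc : Continuous fun q : ℝ≥0 × Ω => (φ q.1 q.2 : ℂ) :=
    continuous_subtype_val.comp (hmφ.continuous_flow hΩ)
  have hu : Continuous fun t => (φ t z : ℂ) :=
    hc.comp (f := fun t : ℝ≥0 => (t, z)) (by fun_prop)
  have hol := isHolomorphic_average hΩ hc hmφ.holomorphic_flow h
  have hs : HasStrictDerivAt (extendZero (average (fun t z => (φ t z : ℂ)) h))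
      (cderiv (average (fun t z => (φ t z : ℂ)) h) z) z :=
    (hol.analyticAt (hΩ.mem_nhds z.2)).hasStrictDerivAt
  refine HasRightDeriv.of_comp hu (by simpa [hmφ.semiflow.zero] using hs) hz ?_
  have h1 := hasRightDeriv_average hu hh
  simp only [hmφ.semiflow.zero] at h1
  refine h1.congr_of_mem (fun s _ => ?_) self_mem_Ici
  dsimp only
  rw [extendZero_coe]
  simp only [average, hmφ.semiflow.add]

/-- As h → 0 the averages tend to the identity, so their derivatives at z tend to 1. -/
theorem IsHolomorphicC0CoSemiflow.exists_cderiv_average_ne_zero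
    (hmφ : IsHolomorphicC0CoSemiflow m φ) (hΩ : IsOpen Ω) (z : Ω) :
    ∃ h : ℝ≥0, h ≠ 0 ∧ cderiv (average (fun t z => (φ t z : ℂ)) h) z ≠ 0 := by
  have hc : Continuous fun q : ℝ≥0 × Ω => (φ q.1 q.2 : ℂ) :=
    continuous_subtype_val.comp (hmφ.continuous_flow hΩ)
  have h1 := tendsto_cderiv_average hΩ hc hmφ.holomorphic_flow z
  have h2 : cderiv (fun z => (φ 0 z : ℂ)) z = 1 := by
    simp only [hmφ.semiflow.zero]
    refine HasDerivAt.deriv ((hasDerivAt_id (z : ℂ)).congr_of_eventuallyEq ?_)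
    filter_upwards [hΩ.mem_nhds z.2] with w hw
    exact extendZero_coe _ ⟨w, hw⟩
  rw [h2] at h1
  have h3 := (h1.eventually_ne one_ne_zero).filter_mono (nhdsWithin_le_nhds (s := Ioi 0))
  obtain ⟨h, hh, hh0⟩ := (h3.and self_mem_nhdsWithin).exists
  exact ⟨h, ne_of_gt hh0, hh⟩

theorem IsHolomorphicC0CoSemiflow.hasRightDeriv_flow (hmφ : IsHolomorphicC0CoSemiflow m φ)
    (hΩ : IsOpen Ω) (z : Ω) :
    HasRightDeriv (fun t => (φ t z : ℂ)) (rightDerivZero fun t => (φ t z : ℂ)) := by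
  obtain ⟨h, hh, hz⟩ := hmφ.exists_cderiv_average_ne_zero hΩ z
  have := hmφ.hasRightDeriv_flow_of_ne_zero hΩ hh hz
  rwa [this.rightDerivZero_eq]

/-- One h with a_h'(z₀) ≠ 0 works near z₀, and there φ̇₀(z) = a_h'(z)⁻¹ (φ_h(z) - z) / h is visibly
holomorphic. -/
theorem IsHolomorphicC0CoSemiflow.isHolomorphic_rightDerivZero_flow
    (hmφ : IsHolomorphicC0CoSemiflow m φ) (hΩ : IsOpen Ω) :
    IsHolomorphic fun z => rightDerivZero fun t => (φ t z : ℂ) := by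
  intro z₀ hz₀
  obtain ⟨h, hh, hz⟩ := hmφ.exists_cderiv_average_ne_zero hΩ ⟨z₀, hz₀⟩
  have hc : Continuous fun q : ℝ≥0 × Ω => (φ q.1 q.2 : ℂ) :=
    continuous_subtype_val.comp (hmφ.continuous_flow hΩ)
  set A : ℂ → ℂ := extendZero (average (fun t z => (φ t z : ℂ)) h)
  have hA : DifferentiableOn ℂ A Ω := isHolomorphic_average hΩ hc hmφ.holomorphic_flow h
  have hdA : DifferentiableAt ℂ (deriv A) z₀ := (hA.deriv hΩ).differentiableAt (hΩ.mem_nhds hz₀)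
  have hφ := (hmφ.holomorphic_flow h).differentiableAt (hΩ.mem_nhds hz₀)
  have hd : DifferentiableAt ℂ
      (fun z => (deriv A z)⁻¹ * ((h : ℂ)⁻¹ * (extendZero (fun z => (φ h z : ℂ)) z - z))) z₀ :=
    (hdA.inv hz).mul ((hφ.sub differentiableAt_id).const_mul _)
  refine (hd.congr_of_eventuallyEq ?_).differentiableWithinAt
  filter_upwards [hΩ.mem_nhds hz₀, hdA.continuousAt.eventually_ne hz] with z hzΩ hz0
  have := (hmφ.hasRightDeriv_flow_of_ne_zero hΩ hh (z := ⟨z, hzΩ⟩) hz0).rightDerivZero_eq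
  rw [extendZero_coe _ ⟨z, hzΩ⟩, extendZero_coe _ ⟨z, hzΩ⟩, this]
  rfl

/-- The semigroup law moves the derivative at zero along the orbit: the right derivative at t is
φ̇₀(φ_t(z)), continuous in t. -/
theorem IsHolomorphicC0CoSemiflow.isC1_flow (hmφ : IsHolomorphicC0CoSemiflow m φ)
    (hΩ : IsOpen Ω) (z : Ω) : IsC1 fun t => (φ t z : ℂ) := by
  have hc : Continuous fun t => φ t z :=
    (hmφ.continuous_flow hΩ).comp (f := fun t : ℝ≥0 => (t, z)) (by fun_prop)
  refine isC1_of_hasRightDeriv (continuous_subtype_val.comp hc)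
    ((hmφ.isHolomorphic_rightDerivZero_flow hΩ).continuous.comp hc) fun t => ?_
  refine (hmφ.hasRightDeriv_flow hΩ (φ t z)).congr_of_mem (fun s _ => ?_) self_mem_Ici
  dsimp only
  rw [add_comm, hmφ.semiflow.add]

theorem IsHolomorphicC0CoSemiflow.hasRightDeriv_weightedComp
    (hmφ : IsHolomorphicC0CoSemiflow m φ) (hΩ : IsOpen Ω) (hm : ∀ z, IsC1 fun t => m t z)
    {f : Ω → ℂ} (hf : IsHolomorphic f) (z : Ω) :
    HasRightDeriv (fun t => weightedComp m φ t f z) (generatorExpr m φ f z) := by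
  have h1 := (hm z).hasRightDeriv
  have h2 := hmφ.hasRightDeriv_flow hΩ z
  unfold HasRightDeriv at *
  have h3 := HasDerivAt.comp_hasDerivWithinAt (h₂ := extendZero f) (h₂' := cderiv f z) (0 : ℝ)
    (by simpa [hmφ.semiflow.zero] using hf.hasDerivAt hΩ z) h2
  have h4 := h1.mul h3
  simp only [Real.toNNReal_zero, hmφ.semicocycle.zero, hmφ.semiflow.zero, Function.comp_apply,
    extendZero_coe] at h4
  have h5 : generatorExpr m φ f z = (rightDerivZero fun t => m t z) * f z +
      1 * (cderiv f z * rightDerivZero fun t => (φ t z : ℂ)) := by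
    unfold generatorExpr
    ring
  rw [h5]
  refine h4.congr_of_mem (fun s _ => ?_) self_mem_Ici
  simp [weightedComp, extendZero_coe]

/-- The semigroup property along orbits turns the right derivative at zero into a right derivative
at every time. -/
theorem IsHolomorphicC0CoSemiflow.hasRightDeriv_weightedComp_add
    (hmφ : IsHolomorphicC0CoSemiflow m φ) {f : Ω → ℂ} {g : Ω → ℂ}
    (hfg : ∀ z, HasRightDeriv (fun t => weightedComp m φ t f z) (g z)) (t : ℝ≥0) (z : Ω) :
    HasRightDeriv (fun s => weightedComp m φ (t + s) f z) (weightedComp m φ t g z) := by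
  have h1 := (hfg (φ t z)).const_mul (m t z)
  refine h1.congr_of_mem (fun s _ => ?_) self_mem_Ici
  simp only [weightedComp, LinearMap.coe_mk, AddHom.coe_mk, hmφ.semicocycle.add t]
  rw [add_comm t, hmφ.semiflow.add, mul_assoc]

end Flow

/-! ### The semigroup in the compact-open and mixed topologies. -/

section CompactOpen

variable {Ω : Set ℂ} {F : Submodule ℂ (Ω → ℂ)}

theorem tendsto_compactOpen_iff {ι : Type*} {l : Filter ι} {u : ι → F} {f : F} :
    Tendsto u l (@nhds F (compactOpen F) f) ↔
      ∀ K : Set Ω, IsCompact K → TendstoUniformlyOn (fun i => (u i : Ω → ℂ)) f l K := by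
  rw [@nhds_induced, tendsto_comap_iff, UniformOnFun.tendsto_iff_tendstoUniformlyOn]
  rfl

theorem mem_nhds_zero_compactOpen {V : Set F} :
    V ∈ @nhds F (compactOpen F) 0 ↔ ∃ K : Set Ω, IsCompact K ∧ ∃ ε : ℝ, 0 < ε ∧
      ∀ f : F, (∀ z ∈ K, ‖(f : Ω → ℂ) z‖ ≤ ε) → f ∈ V := by
  have hb := (UniformOnFun.hasBasis_nhds_of_basis Ω ℂ {K : Set Ω | IsCompact K}
    (UniformOnFun.ofFun _ ((0 : F) : Ω → ℂ)) ⟨∅, isCompact_empty⟩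
    (fun K hK L hL => ⟨K ∪ L, hK.union hL, subset_union_left, subset_union_right⟩)
    Metric.uniformity_basis_dist_le).comap
      (fun f : F => UniformOnFun.ofFun {K : Set Ω | IsCompact K} (f : Ω → ℂ))
  rw [@nhds_induced, hb.mem_iff]
  constructor
  · rintro ⟨⟨K, ε⟩, ⟨hK, hε⟩, h⟩
    refine ⟨K, hK, ε, hε, fun f hf => h fun z hz => ?_⟩
    simpa [dist_eq_norm] using hf z hz
  · rintro ⟨K, hK, ε, hε, h⟩
    refine ⟨⟨K, ε⟩, ⟨hK, hε⟩, fun f hf => h f fun z hz => ?_⟩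
    simpa [dist_eq_norm] using hf z hz

/-- The seminorm of uniform convergence on a compact set. -/
theorem exists_sup_seminorm (hF : ∀ f ∈ F, IsHolomorphic f) {K : Set Ω} (hK : IsCompact K) :
    ∃ q : Seminorm ℂ F, ∀ f r, 0 ≤ r → (q f ≤ r ↔ ∀ z ∈ K, ‖(f : Ω → ℂ) z‖ ≤ r) := by
  have := isCompact_iff_compactSpace.1 hK
  let L : F →ₗ[ℂ] C(K, ℂ) :=
    { toFun := fun f => ⟨fun z => (f : Ω → ℂ) z, (hF f f.2).continuous.comp continuous_subtype_val⟩
      map_add' := fun f g => rfl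
      map_smul' := fun c f => rfl }
  refine ⟨(normSeminorm ℂ C(K, ℂ)).comp L, fun f r hr => ?_⟩
  rw [Seminorm.comp_apply, coe_normSeminorm, ContinuousMap.norm_le _ hr]
  exact ⟨fun h z hz => h ⟨z, hz⟩, fun h z => h z z.2⟩

/-- Continuity at zero gives p < 1 where |f| ≤ ε on K, and homogeneity turns this into a linear
bound. -/
theorem exists_bound_of_continuous_compactOpen {p : Seminorm ℂ F}
    (hp : Continuous[compactOpen F, inferInstance] p) :
    ∃ K : Set Ω, IsCompact K ∧ ∃ C : ℝ, 0 ≤ C ∧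
      ∀ (f : F) r, 0 ≤ r → (∀ z ∈ K, ‖(f : Ω → ℂ) z‖ ≤ r) → p f ≤ C * r := by
  have h1 : {f | p f < 1} ∈ @nhds F (compactOpen F) 0 :=
    (@Continuous.tendsto F ℝ (compactOpen F) _ p hp 0).eventually_lt_const (by simp)
  obtain ⟨K, hK, ε, hε, h⟩ := mem_nhds_zero_compactOpen.1 h1
  refine ⟨K, hK, ε⁻¹, by positivity, fun f r hr hf => ?_⟩
  refine le_of_forall_gt_imp_ge_of_dense fun b hb => ?_
  have hr' : r < ε * b := by rwa [inv_mul_lt_iff₀ hε] at hb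
  have hb0 : 0 < b := lt_of_le_of_lt (by positivity) hb
  have h2 := h (((b⁻¹ : ℝ) : ℂ) • f) fun z hz => by
    rw [Submodule.coe_smul, Pi.smul_apply, norm_smul, Complex.norm_real,
      Real.norm_of_nonneg (by positivity), inv_mul_le_iff₀ hb0, mul_comm]
    exact (hf z hz).trans hr'.le
  change p _ < 1 at h2
  rw [map_smul_eq_mul, Complex.norm_real, Real.norm_of_nonneg (by positivity),
    inv_mul_lt_iff₀ hb0, mul_one] at h2
  exact h2.le

variable {m : ℝ≥0 → Ω → ℂ} {φ : ℝ≥0 → Ω → Ω}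

/-- K' is the image of [0, t₀] × K under the flow and M bounds the cocycle on [0, t₀] × K; both are
available by joint continuity. -/
theorem IsHolomorphicC0CoSemiflow.exists_bound_weightedComp
    (hmφ : IsHolomorphicC0CoSemiflow m φ) (hΩ : IsOpen Ω) (t₀ : ℝ≥0) {K : Set Ω}
    (hK : IsCompact K) :
    ∃ K' : Set Ω, IsCompact K' ∧ ∃ M : ℝ, 0 ≤ M ∧ ∀ t ≤ t₀, ∀ f : Ω → ℂ, ∀ r, 0 ≤ r →
      (∀ z ∈ K', ‖f z‖ ≤ r) → ∀ z ∈ K, ‖weightedComp m φ t f z‖ ≤ M * r := by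
  have hc := (isCompact_Icc (a := 0) (b := t₀)).prod hK
  obtain ⟨M, hM⟩ := hc.exists_bound_of_continuousOn (hmφ.continuous_cocycle hΩ).continuousOn
  refine ⟨_, hc.image (hmφ.continuous_flow hΩ), max M 0, le_max_right _ _,
    fun t ht f r hr hf z hz => ?_⟩
  have htz : (t, z) ∈ Icc 0 t₀ ×ˢ K := ⟨⟨zero_le, ht⟩, hz⟩
  change ‖m t z * f (φ t z)‖ ≤ _
  rw [norm_mul]
  exact mul_le_mul ((hM _ htz).trans (le_max_left _ _)) (hf _ ⟨_, htz, rfl⟩) (norm_nonneg _)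
    (le_max_right _ _)

variable {hinv : ∀ t, ∀ f ∈ F, weightedComp m φ t f ∈ F}

local notation "T" => weightedCompSemigroup m φ F hinv

theorem IsHolomorphicC0CoSemiflow.semigroup_zero (hmφ : IsHolomorphicC0CoSemiflow m φ) :
    T 0 = LinearMap.id := by
  ext f z
  simp [weightedCompSemigroup, weightedComp, hmφ.semicocycle.zero, hmφ.semiflow.zero]

theorem IsHolomorphicC0CoSemiflow.semigroup_add (hmφ : IsHolomorphicC0CoSemiflow m φ)
    (t s : ℝ≥0) : T (t + s) = T t ∘ₗ T s := by
  ext f z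
  have h := hmφ.semiflow.add s t z
  rw [add_comm] at h
  simp [weightedCompSemigroup, weightedComp, hmφ.semicocycle.add, h, mul_assoc]

theorem IsHolomorphicC0CoSemiflow.exists_nhds_semigroup (hmφ : IsHolomorphicC0CoSemiflow m φ)
    (hΩ : IsOpen Ω) (t₀ : ℝ≥0) {V : Set F} (hV : V ∈ @nhds F (compactOpen F) 0) :
    ∃ W ∈ @nhds F (compactOpen F) 0, ∀ f ∈ W, ∀ t ≤ t₀, T t f ∈ V := by
  obtain ⟨K, hK, ε, hε, hKV⟩ := mem_nhds_zero_compactOpen.1 hV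
  obtain ⟨K', hK', M, hM, h⟩ := hmφ.exists_bound_weightedComp hΩ t₀ hK
  have hM1 : 0 < M + 1 := by linarith
  refine ⟨{f | ∀ z ∈ K', ‖(f : Ω → ℂ) z‖ ≤ ε / (M + 1)},
    mem_nhds_zero_compactOpen.2 ⟨K', hK', ε / (M + 1), by positivity, fun f hf => hf⟩,
    fun f hf t ht => hKV _ fun z hz => ?_⟩
  refine (h t ht f _ (by positivity) hf z hz).trans ?_
  rw [mul_div_assoc', div_le_iff₀ hM1]
  nlinarith

theorem continuous_seminorm_of_sup (hlin : IsLinearTopology (compactOpen F)) {K : Set Ω}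
    (hK : IsCompact K) {q : Seminorm ℂ F}
    (hq : ∀ f r, 0 ≤ r → (q f ≤ r ↔ ∀ z ∈ K, ‖(f : Ω → ℂ) z‖ ≤ r)) :
    Continuous[compactOpen F, inferInstance] q := by
  have h2 := hlin.2
  refine @Seminorm.continuous' ℂ F _ _ _ (compactOpen F) hlin.1
    (@ContinuousSMul.continuousConstSMul ℂ F _ (compactOpen F) _ h2) q 1 ?_
  refine mem_nhds_zero_compactOpen.2 ⟨K, hK, 1, one_pos, fun f hf => ?_⟩
  rw [Seminorm.mem_closedBall_zero]
  exact (hq f 1 zero_le_one).2 hf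

theorem IsHolomorphicC0CoSemiflow.locallyEquicontinuous (hmφ : IsHolomorphicC0CoSemiflow m φ)
    (hΩ : IsOpen Ω) (hF : ∀ f ∈ F, IsHolomorphic f) (hlin : IsLinearTopology (compactOpen F)) :
    LocallyEquicontinuous (compactOpen F) T := by
  intro t₀ p hp
  obtain ⟨K, hK, C, hC, hpC⟩ := exists_bound_of_continuous_compactOpen hp
  obtain ⟨K', hK', M, hM, h⟩ := hmφ.exists_bound_weightedComp hΩ t₀ hK
  obtain ⟨q, hq⟩ := exists_sup_seminorm hF hK'
  refine ⟨q, continuous_seminorm_of_sup hlin hK' hq, C * M, by positivity, fun t f => ?_⟩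
  rw [mul_assoc]
  refine hpC _ _ (mul_nonneg hM (apply_nonneg q f)) ?_
  exact h t t.2 f _ (apply_nonneg q f) ((hq f _ (apply_nonneg q f)).1 le_rfl)

theorem IsHolomorphicC0CoSemiflow.continuous_orbit (hmφ : IsHolomorphicC0CoSemiflow m φ)
    (hΩ : IsOpen Ω) (hF : ∀ f ∈ F, IsHolomorphic f) (f : F) :
    Continuous[inferInstance, compactOpen F] fun t => T t f := by
  refine (@continuous_iff_continuousAt _ _ _ (compactOpen F) _).2 fun t => ?_
  refine tendsto_compactOpen_iff.2 fun K hK => ?_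
  have := isCompact_iff_compactSpace.1 hK
  obtain ⟨c, hc, hch⟩ := exists_continuous_restrict (h := fun t => weightedComp m φ t f)
    (hmφ.continuous_weightedComp hΩ (hF f f.2).continuous) K
  have h1 := hc.tendsto t
  rw [ContinuousMap.tendsto_iff_tendstoUniformly, Metric.tendstoUniformly_iff] at h1
  rw [Metric.tendstoUniformlyOn_iff]
  intro ε hε
  filter_upwards [h1 ε hε] with s hs z hz
  have := hs ⟨z, hz⟩
  rwa [hch, hch] at this

variable {ν : Seminorm ℂ F}

local notation "γ" => mixedTopology ν (compactOpen F)

theorem IsHolomorphicC0CoSemiflow.continuous_orbit_mixed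
    (hmφ : IsHolomorphicC0CoSemiflow m φ) (hΩ : IsOpen Ω) (hF : ∀ f ∈ F, IsHolomorphic f)
    (hpre : IsPreSaks ν (compactOpen F)) (hbdd : LocallyBounded ν T) (f : F) :
    Continuous[inferInstance, γ] fun t => T t f := by
  refine (@continuous_iff_continuousAt _ _ _ γ _).2 fun t => ?_
  obtain ⟨M, hM⟩ := hbdd (t + 1)
  refine hpre.tendsto_mixed (R := M * ν f) ?_
    (@Continuous.tendsto _ _ _ (compactOpen F) _ (hmφ.continuous_orbit hΩ hF f) t)
  filter_upwards [gt_mem_nhds (lt_add_of_pos_right t zero_lt_one)] with s hs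
  exact hM s (le_of_lt hs) f

theorem IsHolomorphicC0CoSemiflow.continuous_semigroup_mixed
    (hmφ : IsHolomorphicC0CoSemiflow m φ) (hΩ : IsOpen Ω)
    (hpre : IsPreSaks ν (compactOpen F)) (hbdd : LocallyBounded ν T) (t : ℝ≥0) :
    Continuous[γ, γ] (T t) := by
  obtain ⟨M, hM⟩ := hbdd t
  refine hpre.continuous_mixed (hM t le_rfl) ?_
  refine @continuous_of_continuousAt_zero F (compactOpen F) _ hpre.linear.1 F _ _ (compactOpen F)
    hpre.linear.1.toContinuousAdd _ _ (T t) ?_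
  unfold ContinuousAt
  rw [map_zero]
  intro V hV
  obtain ⟨W, hW, h⟩ := hmφ.exists_nhds_semigroup (hinv := hinv) hΩ t hV
  exact mem_map.2 (mem_of_superset hW fun f hf => h f hf t le_rfl)

/-- On norm balls, the semigroup is equicontinuous at zero on bounded time intervals, from the
compact-open topology to the mixed topology. -/
theorem IsHolomorphicC0CoSemiflow.exists_nhds_seminorm_semigroup
    (hmφ : IsHolomorphicC0CoSemiflow m φ) (hΩ : IsOpen Ω)
    (hpre : IsPreSaks ν (compactOpen F)) (hbdd : LocallyBounded ν T) (t₀ : ℝ≥0)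
    {p : Seminorm ℂ F} (hp : Continuous[γ, inferInstance] p) (R : ℝ) {ε : ℝ} (hε : 0 < ε) :
    ∃ W ∈ @nhds F (compactOpen F) 0, ∀ f ∈ W, ν f ≤ R → ∀ t ≤ t₀, p (T t f) ≤ ε := by
  obtain ⟨M, hM⟩ := hbdd t₀
  have h1 : {f | p f < ε} ∈ @nhds F γ 0 :=
    (@Continuous.tendsto F ℝ γ _ p hp 0).eventually_lt_const (by simpa using hε)
  obtain ⟨V, hV, hVp⟩ := hpre.exists_nhds_of_mixed (|M| * R) h1
  obtain ⟨W, hW, hWV⟩ := hmφ.exists_nhds_semigroup (hinv := hinv) hΩ t₀ hV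
  refine ⟨W, hW, fun f hf hfR t ht => le_of_lt (hVp _ (hWV f hf t ht) ((hM t ht f).trans ?_))⟩
  exact (mul_le_mul_of_nonneg_right (le_abs_self M) (apply_nonneg ν f)).trans (by gcongr)

theorem IsHolomorphicC0CoSemiflow.locallyEquicontinuous_mixed
    (hmφ : IsHolomorphicC0CoSemiflow m φ) (hΩ : IsOpen Ω)
    (hpre : IsPreSaks ν (compactOpen F)) (hbdd : LocallyBounded ν T) :
    LocallyEquicontinuous γ T := by
  intro t₀
  obtain ⟨M, hM⟩ := hbdd t₀
  have : Nonempty (Iic t₀) := ⟨⟨t₀, self_mem_Iic⟩⟩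
  refine hpre.equicontinuousFamily_mixed (M := M) (fun t f => hM t t.2 f) fun p hp R ε hε => ?_
  obtain ⟨W, hW, h⟩ := hmφ.exists_nhds_seminorm_semigroup hΩ hpre hbdd t₀ hp R hε
  exact ⟨W, hW, fun f hf hfR t => h f hf hfR t t.2⟩

theorem IsHolomorphicC0CoSemiflow.isBiContinuous
    (hmφ : IsHolomorphicC0CoSemiflow m φ) (hΩ : IsOpen Ω) (hF : ∀ f ∈ F, IsHolomorphic f)
    (hpre : IsPreSaks ν (compactOpen F)) (hbdd : LocallyBounded ν T) :
    IsBiContinuous ν (compactOpen F) T where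
  map_zero := hmφ.semigroup_zero
  map_add := hmφ.semigroup_add
  exponentiallyBounded := hbdd.exponentiallyBounded hmφ.semigroup_zero hmφ.semigroup_add
  orbits := hmφ.continuous_orbit hΩ hF
  biEquicontinuous := fun t₀ u x _ hu V hV => by
    obtain ⟨W, hW, h⟩ := hmφ.exists_nhds_semigroup (hinv := hinv) hΩ t₀ hV
    filter_upwards [(tendsto_nhds_iff_sub hpre.linear).1 hu hW] with n hn t ht
    exact h _ hn t ht

theorem seminorm_rescaled {X : Type*} [AddCommGroup X] [Module ℂ X] (p : Seminorm ℂ X) (ω : ℝ)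
    (S : ℝ≥0 → X →ₗ[ℂ] X) (t : ℝ≥0) (x : X) :
    p (rescaled ω S t x) = Real.exp (-(ω * t)) * p (S t x) := by
  rw [rescaled, LinearMap.smul_apply, map_smul_eq_mul, Complex.norm_real,
    Real.norm_of_nonneg (Real.exp_pos _).le]

/-- The rescaled semigroup is small in norm after a long time. -/
theorem exists_time_rescaled {X : Type*} [AddCommGroup X] [Module ℂ X] {ν p : Seminorm ℂ X}
    {S : ℝ≥0 → X →ₗ[ℂ] X} {M ω C : ℝ}
    (hS : ∀ (t : ℝ≥0) x, ν (S t x) ≤ M * Real.exp (ω * t) * ν x) (hC : 0 ≤ C)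
    (hp : ∀ x, p x ≤ C * ν x) {ε : ℝ} (hε : 0 < ε) :
    ∃ t₀ : ℝ≥0, ∀ t, t₀ ≤ t → ∀ x, p (rescaled (ω + 1) S t x) ≤ ε * ν x := by
  -- The rate ω + 1 instead of ω leaves a factor e^{-t}.
  have h1 : Tendsto (fun t : ℝ => C * M * Real.exp (-t)) atTop (𝓝 0) := by
    simpa using (Real.tendsto_exp_neg_atTop_nhds_zero).const_mul (C * M)
  obtain ⟨t₀, ht₀⟩ := (h1.eventually_le_const hε).exists_forall_of_atTop
  refine ⟨t₀.toNNReal, fun t ht x => ?_⟩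
  rw [seminorm_rescaled]
  calc Real.exp (-((ω + 1) * t)) * p (S t x)
      ≤ Real.exp (-((ω + 1) * t)) * (C * (M * Real.exp (ω * t) * ν x)) := by
        gcongr
        exact (hp _).trans (by gcongr; exact hS t x)
    _ = C * M * Real.exp (-t) * ν x := by
        rw [show -(t : ℝ) = -((ω + 1) * t) + ω * t by ring, Real.exp_add]
        ring
    _ ≤ ε * ν x := by
        gcongr
        exact ht₀ t (Real.toNNReal_le_iff_le_coe.1 ht)

theorem exp_neg_le {ω : ℝ} {t t₀ : ℝ≥0} (ht : t ≤ t₀) :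
    Real.exp (-(ω * t)) ≤ Real.exp (|ω| * t₀) := by
  refine Real.exp_le_exp.2 ?_
  have h1 : -(ω * t) ≤ |ω| * t := by
    rw [← neg_mul]
    exact mul_le_mul_of_nonneg_right (neg_le_abs ω) t.coe_nonneg
  exact h1.trans (mul_le_mul_of_nonneg_left (by exact_mod_cast ht) (abs_nonneg ω))

theorem IsHolomorphicC0CoSemiflow.quasiEquicontinuous_mixed
    (hmφ : IsHolomorphicC0CoSemiflow m φ) (hΩ : IsOpen Ω)
    (hpre : IsPreSaks ν (compactOpen F)) (hbdd : LocallyBounded ν T) :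
    QuasiEquicontinuous γ T := by
  obtain ⟨M, ω, hM1, hM⟩ := hbdd.exponentiallyBounded hmφ.semigroup_zero hmφ.semigroup_add
  refine ⟨ω + 1, hpre.equicontinuousFamily_mixed (M := M) (fun t f => ?_)
    fun p hp R ε hε => ?_⟩
  · rw [seminorm_rescaled]
    calc Real.exp (-((ω + 1) * t)) * ν (T t f)
        ≤ Real.exp (-((ω + 1) * t)) * (M * Real.exp (ω * t) * ν f) := by
          gcongr
          exact hM t f
      _ = M * Real.exp (-t) * ν f := by
          rw [show -(t : ℝ) = -((ω + 1) * t) + ω * t by ring, Real.exp_add]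
          ring
      _ ≤ M * 1 * ν f := by
          gcongr
          simp
      _ = M * ν f := by rw [mul_one]
  · obtain ⟨C, hC, hpC⟩ := exists_le_of_continuous hpre.norm_le_mixed hp
    -- After t₀ the norm estimate alone suffices on the ball of radius R. Before t₀ the tolerance ε
    -- is divided by the largest possible rescaling factor.
    obtain ⟨t₀, ht₀⟩ := exists_time_rescaled hM hC hpC (ε := ε / (|R| + 1)) (by positivity)
    obtain ⟨W, hW, h⟩ := hmφ.exists_nhds_seminorm_semigroup hΩ hpre hbdd t₀ hp R
      (ε := ε / Real.exp (|ω + 1| * t₀)) (by positivity)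
    refine ⟨W, hW, fun f hf hfR t => ?_⟩
    rcases le_total t t₀ with ht | ht
    · rw [seminorm_rescaled]
      calc Real.exp (-((ω + 1) * t)) * p (T t f)
          ≤ Real.exp (|ω + 1| * t₀) * (ε / Real.exp (|ω + 1| * t₀)) :=
            mul_le_mul (exp_neg_le ht) (h f hf hfR t ht) (apply_nonneg p _) (Real.exp_pos _).le
        _ = ε := mul_div_cancel₀ _ (Real.exp_pos _).ne'
    · refine (ht₀ t ht f).trans ?_
      have h1 : ν f ≤ |R| + 1 := hfR.trans ((le_abs_self R).trans (by linarith))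
      calc ε / (|R| + 1) * ν f ≤ ε / (|R| + 1) * (|R| + 1) := by gcongr
        _ = ε := div_mul_cancel₀ _ (by positivity)

/-- Times up to t₀ are controlled by a τ_co-continuous seminorm through local equicontinuity; later
times are absorbed by the term ε ν(f). -/
theorem IsHolomorphicC0CoSemiflow.quasiEquitight
    (hmφ : IsHolomorphicC0CoSemiflow m φ) (hΩ : IsOpen Ω) (hF : ∀ f ∈ F, IsHolomorphic f)
    (hpre : IsPreSaks ν (compactOpen F)) (hbdd : LocallyBounded ν T) :
    QuasiEquitight ν (compactOpen F) T := by
  obtain ⟨M, ω, hM1, hM⟩ := hbdd.exponentiallyBounded hmφ.semigroup_zero hmφ.semigroup_add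
  refine ⟨ω + 1, fun ε hε p hp => ?_⟩
  obtain ⟨C, hC, hpC⟩ := exists_le_of_continuous hpre.coarser hp
  obtain ⟨t₀, ht₀⟩ := exists_time_rescaled hM hC hpC hε
  obtain ⟨q, hq, D, hD, h⟩ := hmφ.locallyEquicontinuous (hinv := hinv) hΩ hF hpre.linear t₀ p hp
  refine ⟨q, hq, Real.exp (|ω + 1| * t₀) * D, by positivity, fun t f => ?_⟩
  rcases le_total t t₀ with ht | ht
  · rw [seminorm_rescaled, mul_assoc]
    refine le_add_of_le_of_nonneg ?_ (by positivity)
    exact mul_le_mul (exp_neg_le ht) (h ⟨t, ht⟩ f) (apply_nonneg p _) (Real.exp_pos _).le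
  · exact (ht₀ t ht f).trans (le_add_of_nonneg_left (by positivity))

end CompactOpen

theorem sub_mem_closure_of_tendsto {X : Type*} [AddCommGroup X] [Module ℂ X]
    {σ : TopologicalSpace X} (hσ : IsLinearTopology σ) {u : ℕ → X} {x w : X} {S : Set X}
    (hu : Tendsto u atTop (@nhds X σ x)) (hS : ∀ n, u n - w ∈ S) : x - w ∈ @closure X σ S := by
  have := hσ.1
  exact mem_closure_of_tendsto (hu.sub_const w) (Eventually.of_forall hS)

theorem exists_nhds_closure_subset {X : Type*} [AddCommGroup X] [Module ℂ X]
    {σ : TopologicalSpace X} (hσ : IsLinearTopology σ) {V : Set X} (hV : V ∈ @nhds X σ 0) :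
    ∃ U ∈ @nhds X σ 0, ∀ S ⊆ U, @closure X σ S ⊆ V := by
  have := hσ.1
  obtain ⟨U, ⟨hU, hUc⟩, hUV⟩ := (closed_nhds_basis (0 : X)).mem_iff.1 hV
  exact ⟨U, hU, fun S hS => (closure_minimal hS hUc).trans hUV⟩

/-! ### The generator and the space of norm-strong continuity. -/

section Generator

variable {Ω : Set ℂ} {F : Submodule ℂ (Ω → ℂ)} {m : ℝ≥0 → Ω → ℂ} {φ : ℝ≥0 → Ω → Ω}
  {hinv : ∀ t, ∀ f ∈ F, weightedComp m φ t f ∈ F} {ν : Seminorm ℂ F}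

local notation "T" => weightedCompSemigroup m φ F hinv

local notation "γ" => mixedTopology ν (compactOpen F)

theorem tendsto_apply_of_mixed (hpre : IsPreSaks ν (compactOpen F)) {ι : Type*} {l : Filter ι}
    {u : ι → F} {f : F} (h : Tendsto u l (@nhds F γ f)) (z : Ω) :
    Tendsto (fun i => (u i : Ω → ℂ) z) l (𝓝 ((f : Ω → ℂ) z)) :=
  (tendsto_compactOpen_iff.1 (h.mono_right (nhds_mono hpre.mixed_le)) {z}
    isCompact_singleton).tendsto_at (mem_singleton z)

theorem convex_le_seminorm (ν : Seminorm ℂ F) (r : ℝ) : Convex ℝ {f : F | ν f ≤ r} := by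
  simpa [Seminorm.closedBall_zero_eq] using ν.convex_closedBall 0 r

/-- The averages of an orbit of `T` belong to `F`, and they are limits of convex combinations of
points of the orbit. -/
theorem IsHolomorphicC0CoSemiflow.exists_average (hmφ : IsHolomorphicC0CoSemiflow m φ)
    (hΩ : IsOpen Ω) (hF : ∀ f ∈ F, IsHolomorphic f) (hpre : IsPreSaks ν (compactOpen F))
    (hseq : IsSeqComplete γ) (hbdd : LocallyBounded ν T) (f : F) (t : ℝ≥0) :
    ∃ J : F, (J : Ω → ℂ) = average (fun s => weightedComp m φ s f) t ∧
      ∀ (w : F) (S : Set F), Convex ℝ S → (∀ s ≤ t, T s f - w ∈ S) → J - w ∈ @closure F γ S := by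
  set h : ℝ≥0 → Ω → ℂ := fun s => weightedComp m φ s f
  have hc : Continuous fun q : ℝ≥0 × Ω => h q.1 q.2 :=
    hmφ.continuous_weightedComp hΩ (hF f f.2).continuous
  let R : ℕ → F := fun n =>
    ∑ i ∈ Finset.range (n + 1), (n + 1 : ℝ)⁻¹ • T (t * ((i : ℝ≥0) / (n + 1))) f
  have hRc : ∀ n, (R n : Ω → ℂ) = riemannSum h t n := fun n => by
    funext z
    simp only [R, riemannSum, Submodule.coe_sum, Finset.sum_apply]
    rfl
  have hconv : ∀ (w : F) (S : Set F), Convex ℝ S → (∀ s ≤ t, T s f - w ∈ S) →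
      ∀ n, R n - w ∈ S := by
    intro w S hS hw n
    have h1 : ∑ _i ∈ Finset.range (n + 1), (n + 1 : ℝ)⁻¹ = 1 := by
      simp [mul_inv_cancel₀ (by positivity : (n + 1 : ℝ) ≠ 0)]
    have h2 : R n - w = ∑ i ∈ Finset.range (n + 1),
        (n + 1 : ℝ)⁻¹ • (T (t * ((i : ℝ≥0) / (n + 1))) f - w) := by
      simp only [smul_sub, Finset.sum_sub_distrib, ← Finset.sum_smul, h1, one_smul, R]
    rw [h2]
    refine hS.sum_mem (fun _ _ => by positivity) h1 fun i hi => hw _ ?_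
    refine mul_le_of_le_one_right zero_le ?_
    rw [div_le_one (by positivity)]
    exact_mod_cast (Finset.mem_range.1 hi).le
  obtain ⟨M, hM⟩ := hbdd t
  -- Norm-boundedness makes the τ_co-Cauchy Riemann sums γ-Cauchy, so that sequential completeness
  -- applies.
  have hRν : ∀ n, ν (R n) ≤ M * ν f := fun n => by
    have := hconv 0 {g | ν g ≤ M * ν f} (convex_le_seminorm ν _)
      (fun s hs => by simpa using hM s hs f) n
    simpa using this
  have hunif : ∀ K : Set Ω, IsCompact K →
      TendstoUniformlyOn (fun n => (R n : Ω → ℂ)) (average h t) atTop K := fun K hK =>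
    (tendstoUniformlyOn_riemannSum hc t hK).congr (Eventually.of_forall fun n z _ => by
      simp only [hRc])
  obtain ⟨J, hJ⟩ := hseq R (by
    refine hpre.tendsto_mixed (R := M * ν f + M * ν f) (Eventually.of_forall fun k =>
      (map_sub_le_add ν _ _).trans (add_le_add (hRν _) (hRν _))) ?_
    refine tendsto_compactOpen_iff.2 fun K hK => ?_
    have h1 := Metric.tendstoUniformlyOn_iff.1 (hunif K hK)
    rw [Metric.tendstoUniformlyOn_iff]
    intro ε hε
    rw [← prod_atTop_atTop_eq]
    filter_upwards [(h1 (ε / 2) (half_pos hε)).prod_mk (h1 (ε / 2) (half_pos hε))]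
      with k hk z hz
    have h2 := dist_triangle_left ((R k.1 : Ω → ℂ) z) ((R k.2 : Ω → ℂ) z) (average h t z)
    have h3 := hk.1 z hz
    have h4 := hk.2 z hz
    rw [dist_comm, dist_eq_norm]
    rw [dist_eq_norm] at h2
    simpa using h2.trans_lt (by linarith))
  refine ⟨J, ?_, fun w S hS hw => ?_⟩
  · funext z
    exact tendsto_nhds_unique (tendsto_apply_of_mixed hpre hJ z)
      ((hunif {z} isCompact_singleton).tendsto_at (mem_singleton z))
  · exact sub_mem_closure_of_tendsto hpre.mixed_linear hJ (hconv w S hS hw)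

theorem eventually_forall_le {P : ℝ≥0 → Prop} (h : ∀ᶠ t in 𝓝 0, P t) :
    ∀ᶠ t in 𝓝 (0 : ℝ≥0), ∀ s ≤ t, P s := by
  obtain ⟨δ, hδ, h⟩ := (nhds_bot_basis (α := ℝ≥0)).eventually_iff.1 h
  filter_upwards [gt_mem_nhds hδ] with t ht s hs
  exact h (hs.trans_lt ht)

/-- The convex set used is a norm ball intersected with a sup-norm ball on a compact set. It
contains T(s)f - f for small s and lies in a prescribed γ-neighbourhood, so local convexity of γ is
never needed. -/
theorem IsHolomorphicC0CoSemiflow.tendsto_of_forall_mem_closure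
    (hmφ : IsHolomorphicC0CoSemiflow m φ) (hΩ : IsOpen Ω) (hF : ∀ f ∈ F, IsHolomorphic f)
    (hpre : IsPreSaks ν (compactOpen F)) (hbdd : LocallyBounded ν T) {f : F} {J : ℝ≥0 → F}
    (hJ : ∀ (t : ℝ≥0) (S : Set F), Convex ℝ S → (∀ s ≤ t, T s f - f ∈ S) →
      J t - f ∈ @closure F γ S) :
    Tendsto J (𝓝 0) (@nhds F γ f) := by
  rw [tendsto_nhds_iff_sub hpre.mixed_linear]
  intro V hV
  obtain ⟨U, hU, hUV⟩ := exists_nhds_closure_subset hpre.mixed_linear hV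
  obtain ⟨M, hM⟩ := hbdd 1
  obtain ⟨W, hW, hWU⟩ := hpre.exists_nhds_of_mixed (M * ν f + ν f) hU
  obtain ⟨K, hK, ε, hε, hKW⟩ := mem_nhds_zero_compactOpen.1 hW
  have h1 : Tendsto (fun t => T t f) (𝓝 0) (@nhds F (compactOpen F) f) := by
    have := @Continuous.tendsto _ _ _ (compactOpen F) _
      (hmφ.continuous_orbit (hinv := hinv) hΩ hF f) 0
    rwa [hmφ.semigroup_zero (hinv := hinv)] at this
  have h2 := eventually_forall_le
    (Metric.tendstoUniformlyOn_iff.1 (tendsto_compactOpen_iff.1 h1 K hK) ε hε)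
  refine mem_map.2 ?_
  filter_upwards [h2, gt_mem_nhds (zero_lt_one (α := ℝ≥0))] with t ht ht1
  refine hUV {g : F | ν g ≤ M * ν f + ν f ∧ ∀ z ∈ K, ‖(g : Ω → ℂ) z‖ ≤ ε}
    (fun g hg => hWU g (hKW g hg.2) hg.1) (hJ t _ ?_ ?_)
  · intro g hg g' hg' a b ha hb hab
    refine ⟨?_, fun z hz => ?_⟩
    · exact convex_le_seminorm ν _ hg.1 hg'.1 ha hb hab
    · have := convex_closedBall (0 : ℂ) ε (x := (g : Ω → ℂ) z) (by simpa using hg.2 z hz)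
        (y := (g' : Ω → ℂ) z) (by simpa using hg'.2 z hz) ha hb hab
      simpa using this
  · intro s hs
    refine ⟨(map_sub_le_add ν _ _).trans (add_le_add (hM s (hs.trans ht1.le) f) le_rfl),
      fun z hz => ?_⟩
    have := ht s hs z hz
    rw [dist_comm, dist_eq_norm] at this
    exact this.le

theorem IsHolomorphicC0CoSemiflow.coe_eq_generatorExpr
    (hmφ : IsHolomorphicC0CoSemiflow m φ) (hΩ : IsOpen Ω) (hF : ∀ f ∈ F, IsHolomorphic f)
    (hpre : IsPreSaks ν (compactOpen F)) (hm : ∀ z, IsC1 fun t => m t z) {f g : F}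
    (hfg : IsGeneratorValue γ T f g) : (g : Ω → ℂ) = generatorExpr m φ f := by
  funext z
  refine tendsto_nhds_unique (tendsto_apply_of_mixed hpre hfg z) ?_
  refine (hmφ.hasRightDeriv_weightedComp hΩ hm (hF f f.2) z).tendsto.congr fun t => ?_
  have h0 : weightedComp m φ 0 f z = (f : Ω → ℂ) z := by
    simp [weightedComp, hmφ.semicocycle.zero, hmφ.semiflow.zero]
  rw [h0]
  rfl

/-- If `φ̇₀ f' + ṁ₀ f` belongs to `F`, the orbit of `f` is an integral of the orbit of this
function. -/
theorem IsHolomorphicC0CoSemiflow.semigroup_sub_eq_smul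
    (hmφ : IsHolomorphicC0CoSemiflow m φ) (hΩ : IsOpen Ω) (hF : ∀ f ∈ F, IsHolomorphic f)
    (hm : ∀ z, IsC1 fun t => m t z) {f g J : F} (hfg : (g : Ω → ℂ) = generatorExpr m φ f)
    {t : ℝ≥0} (hJ : (J : Ω → ℂ) = average (fun s => weightedComp m φ s g) t) :
    T t f - f = ((t : ℝ) : ℂ) • J := by
  ext z
  have hcont : ∀ f ∈ F, Continuous fun t => weightedComp m φ t f z := fun f hf =>
    (hmφ.continuous_weightedComp hΩ (hF f hf).continuous).comp
      (f := fun t : ℝ≥0 => (t, z)) (by fun_prop)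
  have h0 : weightedComp m φ 0 f z = (f : Ω → ℂ) z := by
    simp [weightedComp, hmφ.semicocycle.zero, hmφ.semiflow.zero]
  have h1 := sub_eq_mul_average (hcont f f.2) (hcont g g.2) (fun t =>
    hmφ.hasRightDeriv_weightedComp_add (fun z => by
      rw [hfg]
      exact hmφ.hasRightDeriv_weightedComp hΩ hm (hF f f.2) z) t z) t
  rw [h0] at h1
  change weightedComp m φ t f z - (f : Ω → ℂ) z = ((t : ℝ) : ℂ) * (J : Ω → ℂ) z
  rw [h1, hJ]
  rfl

/-- The difference quotient at t is exactly the average of the orbit of g over [0, t], which tends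
to g. -/
theorem IsHolomorphicC0CoSemiflow.isGeneratorValue_of_eq
    (hmφ : IsHolomorphicC0CoSemiflow m φ) (hΩ : IsOpen Ω) (hF : ∀ f ∈ F, IsHolomorphic f)
    (hpre : IsPreSaks ν (compactOpen F)) (hseq : IsSeqComplete γ) (hbdd : LocallyBounded ν T)
    (hm : ∀ z, IsC1 fun t => m t z) {f g : F} (hfg : (g : Ω → ℂ) = generatorExpr m φ f) :
    IsGeneratorValue γ T f g := by
  choose J hJ hJc using fun t => hmφ.exists_average hΩ hF hpre hseq hbdd g t
  refine ((hmφ.tendsto_of_forall_mem_closure hΩ hF hpre hbdd fun t => hJc t g).mono_left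
    nhdsWithin_le_nhds).congr' ?_
  filter_upwards [self_mem_nhdsWithin] with t ht
  rw [hmφ.semigroup_sub_eq_smul hΩ hF hm hfg (hJ t), inv_smul_smul₀]
  exact_mod_cast ne_of_gt ht

theorem IsHolomorphicC0CoSemiflow.generatorDomain_eq
    (hmφ : IsHolomorphicC0CoSemiflow m φ) (hΩ : IsOpen Ω) (hF : ∀ f ∈ F, IsHolomorphic f)
    (hpre : IsPreSaks ν (compactOpen F)) (hseq : IsSeqComplete γ) (hbdd : LocallyBounded ν T)
    (hm : ∀ z, IsC1 fun t => m t z) :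
    generatorDomain γ T = {f : F | generatorExpr m φ f ∈ F} := by
  ext f
  refine ⟨fun ⟨g, hg⟩ => ?_, fun hf => ?_⟩
  · rw [mem_ofPred_eq, ← hmφ.coe_eq_generatorExpr hΩ hF hpre hm hg]
    exact g.2
  · exact ⟨⟨_, hf⟩, hmφ.isGeneratorValue_of_eq hΩ hF hpre hseq hbdd hm rfl⟩

/-- The function `φ̇₀ J' + ṁ₀ J` for an average `J` of an orbit. -/
theorem IsHolomorphicC0CoSemiflow.generatorExpr_average
    (hmφ : IsHolomorphicC0CoSemiflow m φ) (hΩ : IsOpen Ω) (hF : ∀ f ∈ F, IsHolomorphic f)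
    (hm : ∀ z, IsC1 fun t => m t z) {f J : F} {t : ℝ≥0} (ht : t ≠ 0)
    (hJ : (J : Ω → ℂ) = average (fun s => weightedComp m φ s f) t) :
    generatorExpr m φ J = ((((t : ℝ) : ℂ)⁻¹ • (T t f - f) : F) : Ω → ℂ) := by
  funext z
  have hc : Continuous fun s => weightedComp m φ s f z :=
    (hmφ.continuous_weightedComp hΩ (hF f f.2).continuous).comp
      (f := fun t : ℝ≥0 => (t, z)) (by fun_prop)
  have h0 : weightedComp m φ 0 f z = (f : Ω → ℂ) z := by
    simp [weightedComp, hmφ.semicocycle.zero, hmφ.semiflow.zero]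
  have h1 := hasRightDeriv_average hc ht
  have h2 := hmφ.hasRightDeriv_weightedComp hΩ hm (hF J J.2) z
  have h3 : (fun s => weightedComp m φ s J z) =
      fun s => ∫ σ in (0 : ℝ)..1, weightedComp m φ (t * σ.toNNReal + s) f z := by
    -- The cocycle identity pulls T(s) inside the integral and shifts time by s. The right
    -- derivative at zero is thus known in two ways, and uniqueness gives the formula.
    funext s
    change m s z * (J : Ω → ℂ) (φ s z) = _
    rw [hJ, average, ← intervalIntegral.integral_const_mul]
    refine intervalIntegral.integral_congr fun σ _ => ?_
    simp only [weightedComp, LinearMap.coe_mk, AddHom.coe_mk]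
    rw [hmφ.semiflow.add, add_comm, hmφ.semicocycle.add, mul_assoc]
  rw [h3] at h2
  rw [← h2.rightDerivZero_eq, h1.rightDerivZero_eq, h0]
  rfl

/-- An ε/2 argument: uniform boundedness of S(t) for t ≤ 1 makes the space of strong continuity
norm-closed. -/
theorem tendsto_semigroup_of_mem_closure {X : Type*} [AddCommGroup X] [Module ℂ X]
    {ν : Seminorm ℂ X} {S : ℝ≥0 → X →ₗ[ℂ] X} (hS : LocallyBounded ν S) {D : Set X}
    (hD : D ⊆ strongContinuitySpace ν S) :
    @closure X (normTopology ν) D ⊆ strongContinuitySpace ν S := by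
  intro x hx
  obtain ⟨M, hM⟩ := hS 1
  refine Metric.tendsto_nhds.2 fun ε hε => ?_
  have h1 : {y | ν (y - x) < ε / (2 * (|M| + 1))} ∈ @nhds X (normTopology ν) x := by
    have := (tendsto_normTopology_iff ν (l := @nhds X (normTopology ν) x) (u := id)).1 tendsto_id
    exact this.eventually_lt_const (by positivity)
  obtain ⟨y, hy, hyD⟩ := (@mem_closure_iff_nhds X (normTopology ν) _ _).1 hx _ h1
  have h2 := Metric.tendsto_nhds.1 (hD hyD) (ε / 2) (half_pos hε)
  have h3 : ∀ᶠ t : ℝ≥0 in 𝓝[>] 0, t < 1 :=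
    (gt_mem_nhds (zero_lt_one (α := ℝ≥0))).filter_mono nhdsWithin_le_nhds
  filter_upwards [h2, h3] with t ht ht1
  rw [Real.dist_eq, sub_zero, abs_of_nonneg (apply_nonneg ν _)] at *
  have hy' : ν (y - x) < ε / (2 * (|M| + 1)) := hy
  have h4 : S t x - x = (S t y - y) - S t (y - x) + (y - x) := by
    rw [map_sub]
    abel
  have h5 : ν (S t (y - x)) ≤ |M| * ν (y - x) := (hM t ht1.le _).trans
    (mul_le_mul_of_nonneg_right (le_abs_self M) (apply_nonneg ν _))
  have h6 : (|M| + 1) * ν (y - x) < ε / 2 := by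
    rw [lt_div_iff₀ (by positivity)] at hy'
    linarith
  calc ν (S t x - x) ≤ ν (S t y - y) + ν (S t (y - x)) + ν (y - x) := by
        rw [h4]
        exact (map_add_le_add ν _ _).trans (by gcongr; exact map_sub_le_add ν _ _)
    _ ≤ ν (S t y - y) + (|M| + 1) * ν (y - x) := by linarith
    _ < ε := by linarith

/-- Averages of the orbit of f lie in the domain and approximate a strongly continuous f in norm, up
to the factor C lost on passing to γ-closures of balls. Conversely, T(t)f - f = t J_t with J_t
norm-bounded for t ≤ 1 when f is in the domain. -/
theorem IsHolomorphicC0CoSemiflow.strongContinuitySpace_eq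
    (hmφ : IsHolomorphicC0CoSemiflow m φ) (hΩ : IsOpen Ω) (hF : ∀ f ∈ F, IsHolomorphic f)
    (hpre : IsPreSaks ν (compactOpen F)) (hseq : IsSeqComplete γ) (hbdd : LocallyBounded ν T)
    (hm : ∀ z, IsC1 fun t => m t z) (hcomp : IsSeqComplete (normTopology ν)) :
    strongContinuitySpace ν T =
      @closure F (normTopology ν) {f : F | generatorExpr m φ f ∈ F} := by
  obtain ⟨C, hC⟩ := exists_le_of_mem_closure hpre.norm_definite hpre.mixed_linear
    hpre.hausdorff_mixed hpre.norm_le_mixed hseq hcomp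
  refine Subset.antisymm (fun f hf => ?_) (tendsto_semigroup_of_mem_closure hbdd fun f hf => ?_)
  · refine (@mem_closure_iff_nhds F (normTopology ν) _ _).2 fun V hV => ?_
    choose J hJ hJc using fun t => hmφ.exists_average hΩ hF hpre hseq hbdd f t
    have h1 : Tendsto J (𝓝[>] 0) (@nhds F (normTopology ν) f) := by
      rw [tendsto_normTopology_iff]
      refine Metric.tendsto_nhds.2 fun ε hε => ?_
      have hr : 0 < ε / (|C| + 1) := by positivity
      have h2 : ∀ᶠ t : ℝ≥0 in 𝓝 0, t ∈ Ioi 0 → ν (T t f - f) < ε / (|C| + 1) :=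
        eventually_nhdsWithin_iff.1 (Tendsto.eventually_lt_const hr hf)
      filter_upwards [nhdsWithin_le_nhds (eventually_forall_le h2)] with t ht
      have h3 := hC _ hr _ (hJc t f {g | ν g ≤ ε / (|C| + 1)} (convex_le_seminorm ν _) fun s hs => ?_)
      · rw [Real.dist_eq, sub_zero, abs_of_nonneg (apply_nonneg ν _)]
        refine h3.trans_lt ?_
        rw [mul_div_assoc', div_lt_iff₀ (by positivity)]
        nlinarith [le_abs_self C]
      · rcases eq_or_lt_of_le (zero_le (a := s)) with rfl | hs0
        · rw [mem_ofPred_eq, hmφ.semigroup_zero]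
          simpa using hr.le
        · exact (ht s hs hs0).le
    obtain ⟨t, htV, ht⟩ := ((h1.eventually_mem hV).and self_mem_nhdsWithin).exists
    refine ⟨J t, htV, ?_⟩
    rw [mem_ofPred_eq, hmφ.generatorExpr_average (hinv := hinv) hΩ hF hm (ne_of_gt ht) (hJ t)]
    exact Submodule.coe_mem _
  · set g : F := ⟨_, hf⟩
    choose J hJ hJc using fun t => hmφ.exists_average hΩ hF hpre hseq hbdd g t
    obtain ⟨M, hM⟩ := hbdd 1
    -- The summand 1 keeps the radius positive when g has norm zero.
    have hr : 0 < |M| * ν g + 1 := by positivity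
    have h1 : ∀ t ≤ 1, ν (J t) ≤ C * (|M| * ν g + 1) := fun t ht => by
      refine hC _ hr _ ?_
      rw [← sub_zero (J t)]
      refine hJc t 0 _ (convex_le_seminorm ν _) fun s hs => ?_
      rw [mem_ofPred_eq, sub_zero]
      have h2 := hM s (hs.trans ht) g
      have h3 := mul_le_mul_of_nonneg_right (le_abs_self M) (apply_nonneg ν g)
      linarith
    have h4 : Tendsto (fun t : ℝ≥0 => (t : ℝ) * (C * (|M| * ν g + 1))) (𝓝[>] 0) (𝓝 0) := by
      have : Tendsto (fun t : ℝ≥0 => (t : ℝ) * (C * (|M| * ν g + 1))) (𝓝 0) (𝓝 0) :=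
        (NNReal.continuous_coe.mul continuous_const).tendsto' 0 0 (by simp)
      exact this.mono_left nhdsWithin_le_nhds
    refine squeeze_zero' (Eventually.of_forall fun t => apply_nonneg ν _) ?_ h4
    have h5 : ∀ᶠ t : ℝ≥0 in 𝓝[>] 0, t < 1 :=
      (gt_mem_nhds (zero_lt_one (α := ℝ≥0))).filter_mono nhdsWithin_le_nhds
    filter_upwards [h5] with t ht
    rw [hmφ.semigroup_sub_eq_smul hΩ hF hm (g := g) rfl (hJ t), map_smul_eq_mul, Complex.norm_real,
      Real.norm_of_nonneg t.coe_nonneg]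
    exact mul_le_mul_of_nonneg_left (h1 t ht.le) t.coe_nonneg

end Generator
end Saks

theorem mainTheorem10 {Ω : Set ℂ} (hΩ : IsOpen Ω)
    (F : Submodule ℂ (Ω → ℂ)) (hF : ∀ f ∈ F, Saks.IsHolomorphic f)
    (ν : Seminorm ℂ F)
    (hpre : Saks.IsPreSaks ν (Saks.compactOpen F))
    (hseq : Saks.IsSeqComplete (Saks.mixedTopology ν (Saks.compactOpen F)))
    (m : ℝ≥0 → Ω → ℂ) (φ : ℝ≥0 → Ω → Ω)
    (hmφ : Saks.IsHolomorphicC0CoSemiflow m φ)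
    (hinv : ∀ t, ∀ f ∈ F, Saks.weightedComp m φ t f ∈ F)
    (hbdd : Saks.LocallyBounded ν (Saks.weightedCompSemigroup m φ F hinv)) :
    let τ : TopologicalSpace F := Saks.compactOpen F
    let γ : TopologicalSpace F := Saks.mixedTopology ν τ
    let T : ℝ≥0 → F →ₗ[ℂ] F := Saks.weightedCompSemigroup m φ F hinv
    -- part (a)
    (Saks.StronglyContinuous γ T ∧ Saks.LocallyEquicontinuous τ T ∧
      Saks.LocallyEquicontinuous γ T) ∧
    -- part (b)
    (Saks.IsSaks ν τ → Saks.IsBiContinuous ν τ T) ∧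
    -- part (c)
    (Saks.IsSaks ν τ → Saks.IsCSequential γ →
      Saks.QuasiEquicontinuous γ T ∧
      ∀ Γ : Set (Seminorm ℂ F), Saks.IsNormingSystem ν τ Γ →
        γ = Saks.submixedTopology Γ → Saks.QuasiEquitight ν τ T) ∧
    -- part (d)
    ((∀ z, Saks.IsC1 fun t => m t z) →
      (∀ z, Saks.IsC1 fun t => (φ t z : ℂ)) ∧
      Saks.IsHolomorphic (fun z => Saks.rightDerivZero fun t => (φ t z : ℂ)) ∧
      Saks.generatorDomain γ T = {f : F | Saks.generatorExpr m φ f ∈ F} ∧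
      ∀ f g : F, Saks.IsGeneratorValue γ T f g → (g : Ω → ℂ) = Saks.generatorExpr m φ f) ∧
    -- part (e)
    ((∀ z, Saks.IsC1 fun t => m t z) → Saks.IsSeqComplete (Saks.normTopology ν) →
      Saks.strongContinuitySpace ν T =
        @closure F (Saks.normTopology ν) {f : F | Saks.generatorExpr m φ f ∈ F}) := by
  intro τ γ T
  exact ⟨⟨⟨hmφ.continuous_semigroup_mixed hΩ hpre hbdd,
      hmφ.continuous_orbit_mixed hΩ hF hpre hbdd⟩,
      hmφ.locallyEquicontinuous hΩ hF hpre.linear,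
      hmφ.locallyEquicontinuous_mixed hΩ hpre hbdd⟩,
    fun _ => hmφ.isBiContinuous hΩ hF hpre hbdd,
    fun _ _ => ⟨hmφ.quasiEquicontinuous_mixed hΩ hpre hbdd,
      fun _ _ _ => hmφ.quasiEquitight hΩ hF hpre hbdd⟩,
    fun hm => ⟨hmφ.isC1_flow hΩ, hmφ.isHolomorphic_rightDerivZero_flow hΩ,
      hmφ.generatorDomain_eq hΩ hF hpre hseq hbdd hm,
      fun _ _ => hmφ.coe_eq_generatorExpr hΩ hF hpre hm⟩,
    fun hm hcomp => hmφ.strongContinuitySpace_eq hΩ hF hpre hseq hbdd hm hcomp⟩
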